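/- Let $d$ be an even positive integer. On $\mathbb{C}^d$ let $\Pi_0$ be the projection onto the span of the first $d/2$ standard basis vectors and $\Pi_1=\mathbb{1}-\Pi_0$. Given $N\ge 1$ and unitary $d\times d$ matrices $U_1,\dots,U_N$, define for $a\in\{0,1\}$ $$\Psi_a(\rho)=\operatorname{Tr}(\Pi_a\rho)\,|0\rangle\langle 0|+\operatorname{Tr}(\Pi_{1-a}\rho)\,|1\rangle\langle 1|,\qquad \Phi_a(\rho)=\frac1N\sum_{j=1}^N |j\rangle\langle j|\otimes\Psi_a(U_j\rho U_j^*),$$ so that $\Phi_a$ maps operators on $\mathbb{C}^d$ to operators on $\mathcal{Y}=\mathbb{C}^N\otimes\mathbb{C}^2$. Conventions: for a Hermiticity-preserving linear map $\Phi$ from operators on $\mathcal{X}$ to operators on $\mathcal{Y}$, $\|\Phi\|_{\mathrm{NE}}$ is the maximum of $\|\Phi(\rho)\|_1$ over density operators $\rho$ on $\mathcal{X}$; $\|\Phi\|_{\diamondsuit}$ is the maximum of $\|(\Phi\otimes\mathbb{1})(\rho)\|_1$ over density operators $\rho$ on $\mathcal{X}\otimes\mathcal{X}$; and $\|\Phi\|_{\mathrm{LOCC}}$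 is the maximum of $\operatorname{Tr}\big((P_0-P_1)(\Phi\otimes\mathbb{1})(\rho)\big)$ over density operators $\rho$ on $\mathcal{X}\otimes\mathcal{Z}$ and LOCC binary measurements $\{P_0,P_1\}$ on $\mathcal{Y}\otimes\mathcal{Z}$, where $\mathcal{Z}$ is a space with $\dim\mathcal{Z}\ge\dim\mathcal{X}$. A measurement is called LOCC if it lies in the closure of those implementable by local operations and finitely many rounds of classical communication. (1) For every $N\ge1$ and every choice of unitaries $U_1,\dots,U_N$, the maps $\Phi_0,\Phi_1$ are channels, and they are perfectly distinguished by the following one-way LOCC procedure. The channel $\Phi_a$ is applied to the first half of $|\psi\rangle=d^{-1/2}\sum_{i=1}^d|i\rangle|i\rangle$; Alice, who holds the output, measures it in the standard basis and sends the result $(j,y)$ to Bob, who holds the other half; Bob applies the entrywise complex conjugate $\overline{U_j}$, measures $\{\Pi_0,\Pi_1\}$ with result $z$, and announces $0$ if $y=z$ and $1$ otherwise. The announced bit equals $a$ with probability $1$. Consequently, for every $\mathcal{Z}$ with $\dim\mathcal{Z}\ge d$, $$\|\Phi_0-\Phi_1\|_{\mathrm{LOCC}}=\|\Phi_0-\Phi_1\|_{\diamondsuit}=2.$$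 (2) There is an absolute constant $C$ such that for every even $d\ge 2$: for all sufficiently large $N$ there are unitaries $U_1,\dots,U_N$ with $$\left|\,\|\Phi_0-\Phi_1\|_{\mathrm{NE}}-2\sqrt{\frac{2}{\pi d}}\,\right|\le\frac{C}{d},$$ that is, $\|\Phi_0-\Phi_1\|_{\mathrm{NE}}=2\sqrt{2/(\pi d)}+O(1/d)$. Moreover, if $U_1,U_2,\dots$ are independent and distributed according to the normalized Haar measure on the unitary group, then almost surely this bound holds for $U_1,\dots,U_N$ for all sufficiently large $N$. -/

import Mathlib

open Matrix MeasureTheory Filter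
open scoped Kronecker Topology ComplexOrder

noncomputable section

namespace ChannelDiscrimination

/-! ### States, channels and norms (finite-dimensional spaces `ℂ^X`, `X` a finite index type) -/

/-- Density operators: positive semidefinite with trace one. -/
def IsDensity {X : Type} [Fintype X] (ρ : Matrix X X ℂ) : Prop :=
  ρ.PosSemidef ∧ ρ.trace = 1

/-- The Hilbert-Schmidt inner product `⟨A, B⟩ = Tr (A* B)`. -/
def hsInner {X : Type} [Fintype X] (A B : Matrix X X ℂ) : ℂ :=
  (Aᴴ * B).trace

/-- The trace norm `‖A‖₁`: the sum of the singular values of `A`, i.e. of the square roots of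
the eigenvalues of `A* A`. -/
def traceNorm {X : Type} [Fintype X] [DecidableEq X] (A : Matrix X X ℂ) : ℝ :=
  ∑ i, √((isHermitian_conjTranspose_mul_self A).eigenvalues i)

/-- `Φ ⊗ 𝟙` acting on operators on `ℂ^X ⊗ ℂ^Z`: on the block of entries with fixed
`Z`-indices `z, z'` it acts as `Φ`. -/
def tensorId {X Y : Type} (Z : Type) (Φ : Matrix X X ℂ →ₗ[ℂ] Matrix Y Y ℂ)
    (ρ : Matrix (X × Z) (X × Z) ℂ) : Matrix (Y × Z) (Y × Z) ℂ :=
  Matrix.of fun p q => Φ (Matrix.of fun x x' => ρ (x, p.2) (x', q.2)) p.1 q.1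

/-- Channels: completely positive and trace-preserving linear maps. -/
def IsChannel {X Y : Type} [Fintype X] [Fintype Y]
    (Φ : Matrix X X ℂ →ₗ[ℂ] Matrix Y Y ℂ) : Prop :=
  (∀ (n : ℕ) (ρ : Matrix (X × Fin n) (X × Fin n) ℂ),
      ρ.PosSemidef → (tensorId (Fin n) Φ ρ).PosSemidef) ∧
    ∀ ρ : Matrix X X ℂ, (Φ ρ).trace = ρ.trace

/-- `‖Φ‖_NE = max_ρ ‖Φ(ρ)‖₁` over density operators `ρ` (`Φ` Hermiticity-preserving). -/
def neNorm {X Y : Type} [Fintype X] [Fintype Y] [DecidableEq Y]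
    (Φ : Matrix X X ℂ →ₗ[ℂ] Matrix Y Y ℂ) : ℝ :=
  sSup {r : ℝ | ∃ ρ : Matrix X X ℂ, IsDensity ρ ∧ r = traceNorm (Φ ρ)}

/-- `‖Φ‖_◇ = max_ρ ‖(Φ ⊗ 𝟙)(ρ)‖₁` over density operators `ρ` on `ℂ^X ⊗ ℂ^X`
(`Φ` Hermiticity-preserving). -/
def diamondNorm {X Y : Type} [Fintype X] [DecidableEq X] [Fintype Y] [DecidableEq Y]
    (Φ : Matrix X X ℂ →ₗ[ℂ] Matrix Y Y ℂ) : ℝ :=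
  sSup {r : ℝ | ∃ ρ : Matrix (X × X) (X × X) ℂ, IsDensity ρ ∧ r = traceNorm (tensorId X Φ ρ)}

/-! ### LOCC measurements

A binary-valued measurement on `ℂ^A ⊗ ℂ^B` is given by its two operators `P 0`, `P 1`. -/

/-- The binary-valued measurements implementable by local operations and finitely many rounds
of classical communication. Either the parties announce a fixed outcome, or one of them
applies a local quantum instrument with Kraus operators `K i` (the system of that party may
change from `A` to `A'`), announces the classical result `i`, and they continue with an LOCC
protocol `M i` that depends on `i`. -/
inductive IsFiniteLOCC : ∀ {A B : Type} [Fintype A] [DecidableEq A] [Fintype B] [DecidableEq B],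
    (Fin 2 → Matrix (A × B) (A × B) ℂ) → Prop
  | announce {A B : Type} [Fintype A] [DecidableEq A] [Fintype B] [DecidableEq B] (c : Fin 2) :
      IsFiniteLOCC (fun b => if b = c then (1 : Matrix (A × B) (A × B) ℂ) else 0)
  | alice {A A' B : Type} [Fintype A] [DecidableEq A] [Fintype A'] [DecidableEq A']
      [Fintype B] [DecidableEq B] {k : ℕ} (K : Fin k → Matrix A' A ℂ)
      (hK : ∑ i, (K i)ᴴ * K i = 1)
      (M : Fin k → Fin 2 → Matrix (A' × B) (A' × B) ℂ) (hM : ∀ i, IsFiniteLOCC (M i)) :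
      IsFiniteLOCC (fun b => ∑ i,
        (K i ⊗ₖ (1 : Matrix B B ℂ))ᴴ * M i b * (K i ⊗ₖ (1 : Matrix B B ℂ)))
  | bob {A B B' : Type} [Fintype A] [DecidableEq A] [Fintype B] [DecidableEq B]
      [Fintype B'] [DecidableEq B'] {k : ℕ} (K : Fin k → Matrix B' B ℂ)
      (hK : ∑ i, (K i)ᴴ * K i = 1)
      (M : Fin k → Fin 2 → Matrix (A × B') (A × B') ℂ) (hM : ∀ i, IsFiniteLOCC (M i)) :
      IsFiniteLOCC (fun b => ∑ i,
        ((1 : Matrix A A ℂ) ⊗ₖ K i)ᴴ * M i b * ((1 : Matrix A A ℂ) ⊗ₖ K i))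

/-- LOCC measurements: the closure of the set of those implementable in finitely many rounds. -/
def loccMeasurements (A B : Type) [Fintype A] [DecidableEq A] [Fintype B] [DecidableEq B] :
    Set (Fin 2 → Matrix (A × B) (A × B) ℂ) :=
  closure {P | IsFiniteLOCC P}

/-- One-way LOCC measurements: Alice performs a measurement `E` on `ℂ^A` and sends the result
`i` to Bob, who performs on `ℂ^B` a binary-valued measurement `F i` depending on `i`;
its result is the outcome. -/
def IsOneWayLOCC {A B : Type} [Fintype A] [DecidableEq A] [Fintype B] [DecidableEq B]
    (P : Fin 2 → Matrix (A × B) (A × B) ℂ) : Prop :=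
  ∃ (k : ℕ) (E : Fin k → Matrix A A ℂ) (F : Fin k → Fin 2 → Matrix B B ℂ),
    (∀ i, (E i).PosSemidef) ∧ ∑ i, E i = 1 ∧
    (∀ i b, (F i b).PosSemidef) ∧ (∀ i, ∑ b, F i b = 1) ∧
    ∀ b, P b = ∑ i, E i ⊗ₖ F i b

/-- `‖Φ‖_LOCC`, with ancillary space `ℂ^Z`: the maximum of `⟨P₀ - P₁, (Φ ⊗ 𝟙)(ρ)⟩` over LOCC
measurements `{P₀, P₁}` and density operators `ρ` on `ℂ^X ⊗ ℂ^Z` (`Φ` Hermiticity-preserving). -/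
def loccNorm {X Y : Type} (Z : Type) [Fintype X] [Fintype Y] [DecidableEq Y]
    [Fintype Z] [DecidableEq Z] (Φ : Matrix X X ℂ →ₗ[ℂ] Matrix Y Y ℂ) : ℝ :=
  sSup {r : ℝ | ∃ P ∈ loccMeasurements Y Z, ∃ ρ : Matrix (X × Z) (X × Z) ℂ,
    IsDensity ρ ∧ r = (hsInner (P 0 - P 1) (tensorId Z Φ ρ)).re}

/-! ### The channels -/

/-- `Π₀` and `Π₁`: the projections onto the span of the first `d / 2`, respectively of the
remaining, standard basis vectors of `ℂ^d`. -/
def halfProj (d : ℕ) : Fin 2 → Matrix (Fin d) (Fin d) ℂ :=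
  ![diagonal fun j => if (j : ℕ) < d / 2 then 1 else 0,
    diagonal fun j => if d / 2 ≤ (j : ℕ) then 1 else 0]

/-- `Ψ_a(ρ) = Tr(Π_a ρ) |0⟩⟨0| + Tr(Π_{1-a} ρ) |1⟩⟨1|`, the addition `y + a` being modulo 2. -/
def binaryChannel (d : ℕ) (a : Fin 2) :
    Matrix (Fin d) (Fin d) ℂ →ₗ[ℂ] Matrix (Fin 2) (Fin 2) ℂ where
  toFun ρ := ∑ y : Fin 2, (halfProj d (y + a) * ρ).trace • Matrix.single y y (1 : ℂ)
  map_add' ρ σ := by simp only [mul_add, trace_add, add_smul, Finset.sum_add_distrib]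
  map_smul' c ρ := by
    simp only [mul_smul_comm, trace_smul, smul_eq_mul, mul_smul, Finset.smul_sum, RingHom.id_apply]

/-- `Φ_a(ρ) = (1/N) ∑_j |j⟩⟨j| ⊗ Ψ_a(U_j ρ U_j*)`. -/
def randomBinaryChannel {d N : ℕ} (U : Fin N → unitaryGroup (Fin d) ℂ) (a : Fin 2) :
    Matrix (Fin d) (Fin d) ℂ →ₗ[ℂ] Matrix (Fin N × Fin 2) (Fin N × Fin 2) ℂ where
  toFun ρ := (1 / (N : ℂ)) • ∑ j : Fin N, Matrix.single j j (1 : ℂ) ⊗ₖ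
    binaryChannel d a ((U j : Matrix (Fin d) (Fin d) ℂ) * ρ * (U j : Matrix (Fin d) (Fin d) ℂ)ᴴ)
  map_add' ρ σ := by
    simp only [mul_add, add_mul, map_add, kronecker_add, Finset.sum_add_distrib, smul_add]
  map_smul' c ρ := by
    simp only [mul_smul_comm, smul_mul_assoc, map_smul, kronecker_smul, ← Finset.smul_sum,
      RingHom.id_apply]
    rw [smul_comm]

/-- The canonical maximally entangled state `|ψ⟩⟨ψ|`, `|ψ⟩ = d^{-1/2} ∑_i |i⟩|i⟩`. -/
def maxEntangled (d : ℕ) : Matrix (Fin d × Fin d) (Fin d × Fin d) ℂ :=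
  let ψ : Fin d × Fin d → ℂ := fun p => if p.1 = p.2 then ((1 / √(d : ℝ) : ℝ) : ℂ) else 0
  vecMulVec ψ (star ψ)

/-- The discrimination measurement: Alice measures her two registers in the standard basis and
sends the result `(j, y)` to Bob, who applies the entrywise conjugate of `U_j` and the
measurement `{Π₀, Π₁}` with result `z`; the outcome `b` is `0` if `y = z` and `1` otherwise,
i.e. `z = y + b` modulo 2. -/
def discriminator {d N : ℕ} (U : Fin N → unitaryGroup (Fin d) ℂ) (b : Fin 2) :
    Matrix ((Fin N × Fin 2) × Fin d) ((Fin N × Fin 2) × Fin d) ℂ :=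
  ∑ j : Fin N, ∑ y : Fin 2, Matrix.single (j, y) (j, y) (1 : ℂ) ⊗ₖ
    (((U j : Matrix (Fin d) (Fin d) ℂ).map star)ᴴ * halfProj d (y + b) *
      (U j : Matrix (Fin d) (Fin d) ℂ).map star)

/-! ### Haar measure on the unitary group -/

instance instCompactSpaceUnitary (d : ℕ) : CompactSpace (unitaryGroup (Fin d) ℂ) := by
  refine isCompact_iff_compactSpace.mp ?_
  have hK : IsCompact (Set.pi Set.univ fun _ : Fin d => Set.pi Set.univ fun _ : Fin d =>
      Metric.closedBall (0 : ℂ) 1) :=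
    isCompact_univ_pi fun _ => isCompact_univ_pi fun _ => isCompact_closedBall _ _
  refine IsCompact.of_isClosed_subset (X := Matrix (Fin d) (Fin d) ℂ) hK
    (isClosed_unitary (R := Matrix (Fin d) (Fin d) ℂ)) ?_
  intro V hV i _ j _
  simpa using entry_norm_bound_of_unitary hV i j

instance instMeasurableSpaceUnitary (d : ℕ) : MeasurableSpace (unitaryGroup (Fin d) ℂ) := borel _

instance instBorelSpaceUnitary (d : ℕ) : BorelSpace (unitaryGroup (Fin d) ℂ) := ⟨rfl⟩

/-- The Haar measure on the unitary group, normalized to total mass one. -/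
def haarUnitary (d : ℕ) : Measure (unitaryGroup (Fin d) ℂ) := Measure.haarMeasure ⊤

instance instIsProbabilityMeasureHaarUnitary (d : ℕ) : IsProbabilityMeasure (haarUnitary d) :=
  ⟨Measure.haarMeasure_self (K₀ := (⊤ : TopologicalSpace.PositiveCompacts _))⟩

end ChannelDiscrimination

end

open ChannelDiscrimination

/-! Perfect discrimination is the transpose trick `(A ⊗ 1)|ψ⟩ = (1 ⊗ Aᵀ)|ψ⟩`. When Alice obtains
`(j, y)`, Bob is left with the unnormalized state `(1/(Nd)) (U_j* Π_{y+a} U_j)ᵀ`. This is a multiple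
of one of the two orthogonal projections that he measures (`tensorId_maxEntangled_block`), so his
result reveals `a`. No binary measurement has bias above `2`, and this bound survives the closure in
the definition of LOCC; hence both assisted norms equal `2`. A larger ancilla is reduced to `ℂ^d` by
an isometry `J`.

Without assistance the two outputs are diagonal, and on a pure state `v` the trace norm of their
difference is twice the average over `j` of the bias `|‖Π₀ U_j v‖² - ‖Π₁ U_j v‖²|`. By convexity
mixed states do no better (`neNorm_mem_Icc`). For Haar-random `U_j` the mean bias is the same for
all unit vectors. It is found by averaging a Gaussian integral over the unitary group: Lebesgue
measure and the Gaussian weight on `ℂ^n × ℂ^n`, `n = d/2`, are invariant, so the mean bias is a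
ratio of two explicit integrals (`integral_bias_mul_exp`), equal to `centralBinom n / 4 ^ n`
(`meanBias_single`). Wallis' product places this within `1/d` of `√(2/(πd))`
(`abs_centralBinom_sub_le`).

It remains to make the convergence uniform on the sphere. The strong law of large numbers controls
the empirical bias at the finitely many points of a `1/d`-net. The empirical bias is `2`-Lipschitz
on the sphere whatever `N` and the `U_j` are, so the control extends to all unit vectors at a cost
of order `1/d`. -/

noncomputable section

namespace ChannelDiscrimination

/-! ### Positive semidefinite matrices and the trace norm -/

section TraceNorm

open scoped MatrixOrder in
theorem exists_eq_conjTranspose_mul_self {X : Type} [Fintype X]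
    {A : Matrix X X ℂ} (hA : A.PosSemidef) : ∃ C : Matrix X X ℂ, A = Cᴴ * C := by
  classical
  exact CStarAlgebra.nonneg_iff_eq_star_mul_self.mp hA.nonneg

theorem trace_mul_nonneg {X : Type} [Fintype X] {A B : Matrix X X ℂ} (hA : A.PosSemidef)
    (hB : B.PosSemidef) : 0 ≤ (A * B).trace := by
  obtain ⟨C, rfl⟩ := exists_eq_conjTranspose_mul_self hA
  rw [mul_assoc, trace_mul_comm]
  exact (hB.mul_mul_conjTranspose_same C).trace_nonneg

theorem re_trace_mul_nonneg {X : Type} [Fintype X] {A B : Matrix X X ℂ} (hA : A.PosSemidef)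
    (hB : B.PosSemidef) : 0 ≤ (A * B).trace.re :=
  (Complex.nonneg_iff.mp (trace_mul_nonneg hA hB)).1

/-- The eigenvalues are, as a multiset, the roots of the characteristic polynomial, which is
unchanged by cyclic permutation of factors. This frees the trace norm from the particular
enumeration of eigenvalues in its definition. -/
theorem traceNorm_eq_sum_sqrt {X : Type} [Fintype X] [DecidableEq X] {A V : Matrix X X ℂ}
    (hV : Vᴴ * V = 1) (g : X → ℝ) (h : Aᴴ * A = V * diagonal (fun i => (g i : ℂ)) * Vᴴ) :
    traceNorm A = ∑ i, √(g i) := by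
  have hc : (Aᴴ * A).charpoly = (diagonal (fun i => (g i : ℂ))).charpoly := by
    rw [h, charpoly_mul_comm, ← mul_assoc, hV, one_mul]
  have h1 := (isHermitian_conjTranspose_mul_self A).roots_charpoly_eq_eigenvalues
  have h2 : (diagonal (fun i => (g i : ℂ))).charpoly.roots =
      Multiset.map (fun i => (g i : ℂ)) Finset.univ.val := by
    rw [charpoly_diagonal, Polynomial.roots_prod]
    · simp [Multiset.bind_singleton]
    · simp [Finset.prod_ne_zero_iff, Polynomial.X_sub_C_ne_zero]
  rw [hc, h2] at h1
  have h3 := congrArg (fun s => (Multiset.map (fun z : ℂ => √z.re) s).sum) h1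
  simp only [Multiset.map_map, Function.comp_def, Complex.ofReal_re] at h3
  exact h3.symm

theorem traceNorm_diagonal {X : Type} [Fintype X] [DecidableEq X] (f : X → ℂ) :
    traceNorm (diagonal f) = ∑ i, ‖f i‖ := by
  rw [traceNorm_eq_sum_sqrt (V := 1) (by simp) (fun i => ‖f i‖ ^ 2)]
  · simp
  · simp [diagonal_conjTranspose, Complex.conj_mul']

theorem exists_diagonalization {X : Type} [Fintype X] [DecidableEq X] {A : Matrix X X ℂ}
    (hA : A.IsHermitian) : ∃ (V : Matrix X X ℂ) (l : X → ℝ), Vᴴ * V = 1 ∧ V * Vᴴ = 1 ∧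
      A = V * diagonal (fun i => (l i : ℂ)) * Vᴴ := by
  refine ⟨hA.eigenvectorUnitary, hA.eigenvalues, ?_, ?_, ?_⟩
  · exact Unitary.coe_star_mul_self _
  · exact Unitary.coe_mul_star_self _
  · conv_lhs => rw [hA.spectral_theorem]
    rfl

theorem traceNorm_eq_sum_abs {X : Type} [Fintype X] [DecidableEq X] {A V : Matrix X X ℂ}
    (hV : Vᴴ * V = 1) (l : X → ℝ) (h : A = V * diagonal (fun i => (l i : ℂ)) * Vᴴ) :
    traceNorm A = ∑ i, |l i| := by
  rw [traceNorm_eq_sum_sqrt hV (fun i => l i ^ 2)]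
  · simp [Real.sqrt_sq_eq_abs]
  · have : Aᴴ = A := by
      rw [h]
      simp [conjTranspose_mul, mul_assoc, diagonal_conjTranspose, Pi.star_def]
    rw [this, h]
    calc V * diagonal (fun i => (l i : ℂ)) * Vᴴ * (V * diagonal (fun i => (l i : ℂ)) * Vᴴ)
        = V * diagonal (fun i => (l i : ℂ)) * (Vᴴ * V) * diagonal (fun i => (l i : ℂ)) * Vᴴ := by
          simp only [mul_assoc]
      _ = _ := by
          rw [hV, mul_one, mul_assoc V, diagonal_mul_diagonal]
          simp [sq]

/-- A binary measurement tells apart two states with bias at most `2`. -/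
theorem re_trace_sub_mul_sub_le_two {X : Type} [Fintype X] [DecidableEq X]
    {P Q σ τ : Matrix X X ℂ} (hP : P.PosSemidef) (hQ : Q.PosSemidef) (hPQ : P + Q = 1)
    (hσ : IsDensity σ) (hτ : IsDensity τ) : ((P - Q) * (σ - τ)).trace.re ≤ 2 := by
  have h1 := re_trace_mul_nonneg hQ hσ.1
  have h2 := re_trace_mul_nonneg hP hτ.1
  have h3 : (P * σ).trace.re + (Q * σ).trace.re = 1 := by
    rw [← Complex.add_re, ← trace_add, ← add_mul, hPQ, one_mul, hσ.2, Complex.one_re]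
  have h4 : (P * τ).trace.re + (Q * τ).trace.re = 1 := by
    rw [← Complex.add_re, ← trace_add, ← add_mul, hPQ, one_mul, hτ.2, Complex.one_re]
  simp only [sub_mul, mul_sub, trace_sub, Complex.sub_re]
  -- By `h3` and `h4` the left side is `2 - 2 Tr(Qσ) - 2 Tr(Pτ)`.
  linarith

/-- The spectral projections of `σ - τ` for nonnegative and negative eigenvalues form a measurement
whose bias is exactly the trace norm (Helstrom). -/
theorem traceNorm_sub_le_two {X : Type} [Fintype X] [DecidableEq X] {σ τ : Matrix X X ℂ}
    (hσ : IsDensity σ) (hτ : IsDensity τ) : traceNorm (σ - τ) ≤ 2 := by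
  obtain ⟨V, l, hV, hV', h⟩ := exists_diagonalization (hσ.1.1.sub hτ.1.1)
  rw [traceNorm_eq_sum_abs hV l h]
  let p : X → ℂ := fun i => if 0 ≤ l i then 1 else 0
  let q : X → ℂ := fun i => if 0 ≤ l i then 0 else 1
  have hp : (diagonal p).PosSemidef := PosSemidef.diagonal fun i => by
    simp only [p]; split_ifs <;> simp
  have hq : (diagonal q).PosSemidef := PosSemidef.diagonal fun i => by
    simp only [q]; split_ifs <;> simp
  have hpq : V * diagonal p * Vᴴ + V * diagonal q * Vᴴ = 1 := by
    rw [← add_mul, ← mul_add, diagonal_add]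
    have : (fun i => p i + q i) = fun _ => 1 := by
      funext i; simp only [p, q]; split_ifs <;> simp
    rw [this, diagonal_one, mul_one, hV']
  have key := re_trace_sub_mul_sub_le_two (hp.mul_mul_conjTranspose_same V)
    (hq.mul_mul_conjTranspose_same V) hpq hσ hτ
  have e : (V * diagonal p * Vᴴ - V * diagonal q * Vᴴ) * (σ - τ) =
      V * (diagonal (fun i => (p i - q i) * (l i : ℂ)) * Vᴴ) := by
    rw [h, ← sub_mul, ← mul_sub, diagonal_sub]
    calc V * diagonal (fun i => p i - q i) * Vᴴ * (V * diagonal (fun i => (l i : ℂ)) * Vᴴ)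
        = V * (diagonal (fun i => p i - q i) * (Vᴴ * V) * diagonal (fun i => (l i : ℂ)) * Vᴴ) := by
          simp only [mul_assoc]
      _ = _ := by rw [hV, mul_one, diagonal_mul_diagonal]
  rw [e, trace_mul_comm, mul_assoc, hV, mul_one, trace_diagonal, Complex.re_sum] at key
  refine le_trans (Finset.sum_le_sum fun i _ => le_of_eq ?_) key
  simp only [p, q]
  split_ifs with h0
  · simp [abs_of_nonneg h0]
  · simp [abs_of_neg (not_le.mp h0)]

/-- In an eigenbasis of `A` the diagonal entries of `P` and `Q` are nonnegative with sum `1`, so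
those of `P - Q` lie in `[-1, 1]`. -/
theorem re_trace_sub_mul_le_traceNorm {X : Type} [Fintype X] [DecidableEq X]
    {P Q A : Matrix X X ℂ} (hP : P.PosSemidef) (hQ : Q.PosSemidef) (hPQ : P + Q = 1)
    (hA : A.IsHermitian) : ((P - Q) * A).trace.re ≤ traceNorm A := by
  obtain ⟨V, l, hV, hV', h⟩ := exists_diagonalization hA
  rw [traceNorm_eq_sum_abs hV l h]
  have hP' := hP.conjTranspose_mul_mul_same V
  have hQ' := hQ.conjTranspose_mul_mul_same V
  have hs : Vᴴ * P * V + Vᴴ * Q * V = 1 := by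
    rw [← add_mul, ← mul_add, hPQ, mul_one, hV]
  have e : ((P - Q) * A).trace =
      ((Vᴴ * P * V - Vᴴ * Q * V) * diagonal (fun i => (l i : ℂ))).trace := by
    rw [h, ← mul_assoc, trace_mul_comm, ← sub_mul, ← mul_sub]
    simp only [mul_assoc]
  rw [e, Matrix.trace, Complex.re_sum]
  refine Finset.sum_le_sum fun i _ => ?_
  have h1 := Complex.nonneg_iff.mp (hP'.diag_nonneg (i := i))
  have h2 := Complex.nonneg_iff.mp (hQ'.diag_nonneg (i := i))
  have h3 := congrArg Complex.re (congrFun (congrFun hs i) i)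
  simp only [Matrix.add_apply, Complex.add_re, one_apply_eq, Complex.one_re] at h3
  simp only [diag_apply, mul_diagonal, Complex.re_mul_ofReal, Matrix.sub_apply, Complex.sub_re]
  refine (le_abs_self _).trans ?_
  rw [abs_mul]
  refine mul_le_of_le_one_left (abs_nonneg _) (abs_le.mpr ⟨?_, ?_⟩) <;> linarith [h1.1, h2.1]

end TraceNorm

/-! ### Kraus decompositions -/

section Kraus

theorem tensorId_sub {X Y Z : Type} (Φ Ψ : Matrix X X ℂ →ₗ[ℂ] Matrix Y Y ℂ)
    (ρ : Matrix (X × Z) (X × Z) ℂ) :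
    tensorId Z (Φ - Ψ) ρ = tensorId Z Φ ρ - tensorId Z Ψ ρ := rfl

theorem trace_tensorId {X Y Z : Type} [Fintype X] [Fintype Y] [Fintype Z]
    {Φ : Matrix X X ℂ →ₗ[ℂ] Matrix Y Y ℂ} (hΦ : ∀ ρ, (Φ ρ).trace = ρ.trace)
    (ρ : Matrix (X × Z) (X × Z) ℂ) : (tensorId Z Φ ρ).trace = ρ.trace := by
  have h : ∀ z, ∑ y, Φ (Matrix.of fun x x' => ρ (x, z) (x', z)) y y = ∑ x, ρ (x, z) (x, z) :=
    fun z => hΦ (Matrix.of fun x x' => ρ (x, z) (x', z))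
  simp only [Matrix.trace, diag_apply, Fintype.sum_prod_type_right]
  exact Finset.sum_congr rfl fun z _ => h z

theorem tensorId_eq_sum {X Y Z ι : Type} [Fintype X] [Fintype Z] [DecidableEq Z]
    [Fintype ι] {Φ : Matrix X X ℂ →ₗ[ℂ] Matrix Y Y ℂ} (A : ι → Matrix Y X ℂ)
    (h : ∀ ρ, Φ ρ = ∑ i, A i * ρ * (A i)ᴴ) (ρ : Matrix (X × Z) (X × Z) ℂ) :
    tensorId Z Φ ρ = ∑ i, (A i ⊗ₖ (1 : Matrix Z Z ℂ)) * ρ * (A i ⊗ₖ (1 : Matrix Z Z ℂ))ᴴ := by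
  ext ⟨y, z⟩ ⟨y', z'⟩
  simp only [tensorId, of_apply, h, Matrix.sum_apply]
  refine Finset.sum_congr rfl fun i _ => ?_
  simp only [mul_apply, conjTranspose_apply, kroneckerMap_apply, Fintype.sum_prod_type, one_apply,
    of_apply, mul_ite, mul_one, mul_zero, ite_mul, zero_mul, Finset.sum_ite_eq, Finset.mem_univ,
    if_true, apply_ite star, star_zero]

/-- Operations on different tensor factors commute. This moves the maximally entangled state into a
larger ancilla. -/
theorem tensorId_conj {X Y Z W ι : Type} [Fintype X] [DecidableEq X] [Fintype Y] [DecidableEq Y]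
    [Fintype Z] [DecidableEq Z] [Fintype W] [DecidableEq W]
    [Fintype ι] {Φ : Matrix X X ℂ →ₗ[ℂ] Matrix Y Y ℂ} (A : ι → Matrix Y X ℂ)
    (h : ∀ ρ, Φ ρ = ∑ i, A i * ρ * (A i)ᴴ) (J : Matrix W Z ℂ) (ρ : Matrix (X × Z) (X × Z) ℂ) :
    tensorId W Φ (((1 : Matrix X X ℂ) ⊗ₖ J) * ρ * ((1 : Matrix X X ℂ) ⊗ₖ J)ᴴ) =
      ((1 : Matrix Y Y ℂ) ⊗ₖ J) * tensorId Z Φ ρ * ((1 : Matrix Y Y ℂ) ⊗ₖ J)ᴴ := by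
  rw [tensorId_eq_sum A h, tensorId_eq_sum A h, Matrix.mul_sum, Matrix.sum_mul]
  refine Finset.sum_congr rfl fun i _ => ?_
  have e : (A i ⊗ₖ (1 : Matrix W W ℂ)) * ((1 : Matrix X X ℂ) ⊗ₖ J) =
      ((1 : Matrix Y Y ℂ) ⊗ₖ J) * (A i ⊗ₖ (1 : Matrix Z Z ℂ)) := by
    simp [← mul_kronecker_mul]
  calc _ = (A i ⊗ₖ (1 : Matrix W W ℂ)) * ((1 : Matrix X X ℂ) ⊗ₖ J) * ρ *
        ((A i ⊗ₖ (1 : Matrix W W ℂ)) * ((1 : Matrix X X ℂ) ⊗ₖ J))ᴴ := by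
        rw [conjTranspose_mul]; simp only [Matrix.mul_assoc]
    _ = _ := by rw [e, conjTranspose_mul]; simp only [Matrix.mul_assoc]

theorem posSemidef_tensorId {X Y Z ι : Type} [Fintype X] [Fintype Y] [Fintype Z] [Fintype ι]
    {Φ : Matrix X X ℂ →ₗ[ℂ] Matrix Y Y ℂ} (A : ι → Matrix Y X ℂ)
    (h : ∀ ρ, Φ ρ = ∑ i, A i * ρ * (A i)ᴴ) {ρ : Matrix (X × Z) (X × Z) ℂ} (hρ : ρ.PosSemidef) :
    (tensorId Z Φ ρ).PosSemidef := by
  classical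
  rw [tensorId_eq_sum A h]
  exact posSemidef_sum _ fun i _ => hρ.mul_mul_conjTranspose_same _

end Kraus

/-! ### The channels in Kraus form -/

section Channels

theorem halfProj_zero (d : ℕ) :
    halfProj d 0 = diagonal fun j : Fin d => if (j : ℕ) < d / 2 then 1 else 0 := rfl

theorem halfProj_one (d : ℕ) :
    halfProj d 1 = diagonal fun j : Fin d => if d / 2 ≤ (j : ℕ) then 1 else 0 := rfl

theorem conjTranspose_halfProj (d : ℕ) (c : Fin 2) : (halfProj d c)ᴴ = halfProj d c := by
  fin_cases c <;>
    simp [halfProj, diagonal_conjTranspose, Pi.star_def, apply_ite (star : ℂ → ℂ)]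

theorem transpose_halfProj (d : ℕ) (c : Fin 2) : (halfProj d c)ᵀ = halfProj d c := by
  fin_cases c <;> simp [halfProj]

theorem halfProj_mul_halfProj (d : ℕ) (b c : Fin 2) :
    halfProj d b * halfProj d c = if b = c then halfProj d c else 0 := by
  have h : ∀ j : Fin d, ¬ (d / 2 ≤ (j : ℕ)) ↔ (j : ℕ) < d / 2 := fun j => not_le
  fin_cases b <;> fin_cases c <;>
    simp only [halfProj, Fin.zero_eta, Fin.mk_one, cons_val_zero, cons_val_one,
      diagonal_mul_diagonal, if_true, zero_ne_one, one_ne_zero, if_false] <;>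
    first
      | (congr 1; funext j; split_ifs <;> simp)
      | (rw [← diagonal_zero]; congr 1; funext j; split_ifs <;> first | omega | simp)

theorem sum_halfProj (d : ℕ) : ∑ c, halfProj d c = 1 := by
  rw [Fin.sum_univ_two, halfProj_zero, halfProj_one, diagonal_add, ← diagonal_one]
  congr 1
  funext j
  split_ifs <;> first | omega | simp

theorem sum_halfProj_add (d : ℕ) (y : Fin 2) : ∑ c, halfProj d (y + c) = 1 := by
  rw [← sum_halfProj d]
  exact Equiv.sum_comp (Equiv.addLeft y) (halfProj d)

theorem trace_halfProj {d : ℕ} (hd : Even d) (c : Fin 2) :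
    (halfProj d c).trace = (d : ℂ) / 2 := by
  obtain ⟨n, rfl⟩ := hd
  have h0 : (halfProj (n + n) 0).trace = n := by
    rw [halfProj_zero, trace_diagonal, Fin.sum_univ_add]
    have : (n + n) / 2 = n := by omega
    simp [this]
  have h1 : (halfProj (n + n) 1).trace = n := by
    rw [halfProj_one, trace_diagonal, Fin.sum_univ_add]
    have : (n + n) / 2 = n := by omega
    simp [this, not_le]
  fin_cases c
  · exact h0.trans (by push_cast; ring)
  · exact h1.trans (by push_cast; ring)

variable {d N : ℕ}

theorem unitary_conjTranspose_mul (V : unitaryGroup (Fin d) ℂ) :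
    (V : Matrix (Fin d) (Fin d) ℂ)ᴴ * (V : Matrix (Fin d) (Fin d) ℂ) = 1 :=
  Unitary.coe_star_mul_self V

theorem binaryChannel_apply (a : Fin 2) (ρ : Matrix (Fin d) (Fin d) ℂ) :
    binaryChannel d a ρ = diagonal fun y => (halfProj d (y + a) * ρ).trace := by
  ext y y'
  fin_cases y <;> fin_cases y' <;>
    simp [binaryChannel]

theorem randomBinaryChannel_apply (U : Fin N → unitaryGroup (Fin d) ℂ) (a : Fin 2)
    (ρ : Matrix (Fin d) (Fin d) ℂ) :
    randomBinaryChannel U a ρ = diagonal fun p => (1 / (N : ℂ)) * (halfProj d (p.2 + a) *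
      ((U p.1 : Matrix (Fin d) (Fin d) ℂ) * ρ * (U p.1 : Matrix (Fin d) (Fin d) ℂ)ᴴ)).trace := by
  ext ⟨j, y⟩ ⟨j', y'⟩
  simp only [randomBinaryChannel, LinearMap.coe_mk, AddHom.coe_mk, Matrix.smul_apply,
    Matrix.sum_apply, kroneckerMap_apply, binaryChannel_apply, diagonal_apply, Matrix.single_apply,
    smul_eq_mul, Prod.mk.injEq]
  by_cases hj : j = j'
  · subst hj
    by_cases hy : y = y' <;> simp [hy]
  · have : ∀ x, ¬ (x = j ∧ x = j') := fun x h => hj (h.1.symm.trans h.2)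
    simp [hj, this]

theorem one_div_sqrt_mul_self (m : ℕ) :
    ((1 / √(m : ℝ) : ℝ) : ℂ) * ((1 / √(m : ℝ) : ℝ) : ℂ) = 1 / (m : ℂ) := by
  rw [← Complex.ofReal_mul, div_mul_div_comm, Real.mul_self_sqrt (Nat.cast_nonneg m)]
  simp

/-- Kraus operators of `Φ_a`, indexed by the output and an index of the input space. -/
def krausOp (U : Fin N → unitaryGroup (Fin d) ℂ) (a : Fin 2) (i : (Fin N × Fin 2) × Fin d) :
    Matrix (Fin N × Fin 2) (Fin d) ℂ :=
  ((1 / √(N : ℝ) : ℝ) : ℂ) • (Matrix.single i.1 i.2 (1 : ℂ) *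
    (halfProj d (i.1.2 + a) * (U i.1.1 : Matrix (Fin d) (Fin d) ℂ)))

/-- The operator with index `((j, y), x)` contributes the `x`-th diagonal entry of `Π U_j ρ U_j* Π`,
with `Π = Π_{y+a}`; summing over `x` gives the trace, by `Π² = Π`. -/
theorem randomBinaryChannel_eq_sum (U : Fin N → unitaryGroup (Fin d) ℂ) (a : Fin 2)
    (ρ : Matrix (Fin d) (Fin d) ℂ) :
    randomBinaryChannel U a ρ = ∑ i, krausOp U a i * ρ * (krausOp U a i)ᴴ := by
  have hN := one_div_sqrt_mul_self N
  have key : ∀ i, krausOp U a i * ρ * (krausOp U a i)ᴴ =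
      Matrix.single i.1 i.1 ((1 / (N : ℂ)) * ((halfProj d (i.1.2 + a) *
        ((U i.1.1 : Matrix (Fin d) (Fin d) ℂ) * ρ * (U i.1.1 : Matrix (Fin d) (Fin d) ℂ)ᴴ) *
        halfProj d (i.1.2 + a)) i.2 i.2)) := by
    intro i
    rw [krausOp, conjTranspose_smul, conjTranspose_mul, conjTranspose_mul, conjTranspose_halfProj,
      conjTranspose_single, star_one, Complex.star_def, Complex.conj_ofReal, Matrix.smul_mul,
      Matrix.smul_mul, Matrix.mul_smul, smul_smul, hN]
    calc _ = (1 / (N : ℂ)) • (Matrix.single i.1 i.2 (1 : ℂ) * (halfProj d (i.1.2 + a) *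
        ((U i.1.1 : Matrix (Fin d) (Fin d) ℂ) * ρ * (U i.1.1 : Matrix (Fin d) (Fin d) ℂ)ᴴ) *
        halfProj d (i.1.2 + a)) * Matrix.single i.2 i.1 (1 : ℂ)) := by
          simp only [Matrix.mul_assoc]
      _ = _ := by
          rw [single_mul_mul_single]
          simp
  simp only [key]
  rw [Fintype.sum_prod_type, randomBinaryChannel_apply]
  have h2 : ∀ p : Fin N × Fin 2, (halfProj d (p.2 + a) *
      ((U p.1 : Matrix (Fin d) (Fin d) ℂ) * ρ * (U p.1 : Matrix (Fin d) (Fin d) ℂ)ᴴ)).trace =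
      ∑ x, (halfProj d (p.2 + a) * ((U p.1 : Matrix (Fin d) (Fin d) ℂ) * ρ *
        (U p.1 : Matrix (Fin d) (Fin d) ℂ)ᴴ) * halfProj d (p.2 + a)) x x := by
    intro p
    change _ = Matrix.trace _
    generalize (U p.1 : Matrix (Fin d) (Fin d) ℂ) * ρ * (U p.1 : Matrix (Fin d) (Fin d) ℂ)ᴴ = M
    rw [trace_mul_comm (halfProj d (p.2 + a) * M), ← mul_assoc, halfProj_mul_halfProj, if_pos rfl]
  simp only [h2, Finset.mul_sum]
  ext p q
  simp only [diagonal_apply, Matrix.sum_apply, Matrix.single_apply]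
  by_cases hpq : p = q
  · subst hpq
    rw [Finset.sum_eq_single p]
    · simp
    · intro r _ hr; simp [hr]
    · simp
  · have : ∀ r, ¬ (r = p ∧ r = q) := fun r h => hpq (h.1.symm.trans h.2)
    simp [hpq, this]

theorem trace_randomBinaryChannel (hN : 0 < N) (U : Fin N → unitaryGroup (Fin d) ℂ) (a : Fin 2)
    (ρ : Matrix (Fin d) (Fin d) ℂ) : (randomBinaryChannel U a ρ).trace = ρ.trace := by
  have h : ∀ j : Fin N, ∑ y : Fin 2, (halfProj d (y + a) *
      ((U j : Matrix (Fin d) (Fin d) ℂ) * ρ * (U j : Matrix (Fin d) (Fin d) ℂ)ᴴ)).trace =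
      ρ.trace := by
    intro j
    rw [← trace_sum, ← Finset.sum_mul]
    simp only [add_comm _ a]
    rw [sum_halfProj_add, one_mul, trace_mul_comm, ← mul_assoc, unitary_conjTranspose_mul, one_mul]
  rw [randomBinaryChannel_apply, trace_diagonal, ← Finset.mul_sum, Fintype.sum_prod_type]
  simp only [h]
  have : (N : ℂ) ≠ 0 := by exact_mod_cast hN.ne'
  simp [this]

theorem isChannel_randomBinaryChannel (hN : 0 < N) (U : Fin N → unitaryGroup (Fin d) ℂ)
    (a : Fin 2) : IsChannel (randomBinaryChannel U a) :=
  ⟨fun _ _ hρ => posSemidef_tensorId _ (randomBinaryChannel_eq_sum U a) hρ,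
    trace_randomBinaryChannel hN U a⟩

theorem isDensity_tensorId {Z : Type} [Fintype Z] (hN : 0 < N)
    (U : Fin N → unitaryGroup (Fin d) ℂ) (a : Fin 2) {ρ : Matrix (Fin d × Z) (Fin d × Z) ℂ}
    (hρ : IsDensity ρ) : IsDensity (tensorId Z (randomBinaryChannel U a) ρ) :=
  ⟨posSemidef_tensorId _ (randomBinaryChannel_eq_sum U a) hρ.1,
    (trace_tensorId (trace_randomBinaryChannel hN U a) ρ).trans hρ.2⟩

/-- The operator `Ū_j^* Π_{y+b} Ū_j` measured by Bob after receiving `(j, y)`. -/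
def bobEffect (U : Fin N → unitaryGroup (Fin d) ℂ) (p : Fin N × Fin 2) (b : Fin 2) :
    Matrix (Fin d) (Fin d) ℂ :=
  ((U p.1 : Matrix (Fin d) (Fin d) ℂ).map star)ᴴ * halfProj d (p.2 + b) *
      (U p.1 : Matrix (Fin d) (Fin d) ℂ).map star

theorem map_star_conjTranspose_mul (V : unitaryGroup (Fin d) ℂ) :
    ((V : Matrix (Fin d) (Fin d) ℂ).map star)ᴴ * (V : Matrix (Fin d) (Fin d) ℂ).map star = 1 := by
  have h := congrArg (fun M => Mᵀ) (unitary_conjTranspose_mul V)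
  have e : ((V : Matrix (Fin d) (Fin d) ℂ).map star)ᴴ = (V : Matrix (Fin d) (Fin d) ℂ)ᵀ := by
    ext i j
    simp
  rw [e]
  simpa [conjTranspose, transpose_mul, ← transpose_map] using h

theorem map_star_mul_conjTranspose (V : unitaryGroup (Fin d) ℂ) :
    (V : Matrix (Fin d) (Fin d) ℂ).map star * ((V : Matrix (Fin d) (Fin d) ℂ).map star)ᴴ = 1 :=
  mul_eq_one_comm.mp (map_star_conjTranspose_mul V)

theorem posSemidef_halfProj (d : ℕ) (c : Fin 2) : (halfProj d c).PosSemidef := by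
  have h := posSemidef_conjTranspose_mul_self (halfProj d c)
  rwa [conjTranspose_halfProj, halfProj_mul_halfProj, if_pos rfl] at h

theorem posSemidef_bobEffect (U : Fin N → unitaryGroup (Fin d) ℂ) (p : Fin N × Fin 2)
    (b : Fin 2) : (bobEffect U p b).PosSemidef :=
  (posSemidef_halfProj d _).conjTranspose_mul_mul_same _

theorem sum_bobEffect (U : Fin N → unitaryGroup (Fin d) ℂ) (p : Fin N × Fin 2) :
    ∑ b, bobEffect U p b = 1 := by
  simp only [bobEffect]
  rw [← Finset.sum_mul, ← Finset.mul_sum, sum_halfProj_add, mul_one, map_star_conjTranspose_mul]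

theorem discriminator_eq_sum (U : Fin N → unitaryGroup (Fin d) ℂ) (b : Fin 2) :
    discriminator U b = ∑ p, Matrix.single p p (1 : ℂ) ⊗ₖ bobEffect U p b := by
  rw [Fintype.sum_prod_type]
  rfl

theorem sum_single_self {Y : Type} [Fintype Y] [DecidableEq Y] :
    ∑ p : Y, Matrix.single p p (1 : ℂ) = 1 := by
  ext p q
  simp only [Matrix.sum_apply, Matrix.single_apply, Matrix.one_apply]
  by_cases h : p = q
  · subst h; simp
  · have : ∀ r, ¬ (r = p ∧ r = q) := fun r hr => h (hr.1.symm.trans hr.2)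
    simp [h, this]

theorem posSemidef_single_self {Y : Type} [Finite Y] [DecidableEq Y] (p : Y) :
    (Matrix.single p p (1 : ℂ)).PosSemidef := by
  rw [← diagonal_single]
  exact PosSemidef.diagonal (Pi.single_nonneg.mpr zero_le_one)

theorem isOneWayLOCC_discriminator (U : Fin N → unitaryGroup (Fin d) ℂ) :
    IsOneWayLOCC (discriminator U) := by
  -- One-way measurements have outcomes in some `Fin k`, so the pairs `(j, y)` are enumerated.
  let e := (Fintype.equivFin (Fin N × Fin 2)).symm
  refine ⟨_, fun i => Matrix.single (e i) (e i) 1, fun i => bobEffect U (e i),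
    fun i => posSemidef_single_self _, ?_, fun i => posSemidef_bobEffect U _,
    fun i => sum_bobEffect U _, fun b => ?_⟩
  · rw [Equiv.sum_comp e fun p => Matrix.single p p (1 : ℂ), sum_single_self]
  · rw [Equiv.sum_comp e fun p => Matrix.single p p (1 : ℂ) ⊗ₖ bobEffect U p b,
      discriminator_eq_sum]

theorem posSemidef_discriminator (U : Fin N → unitaryGroup (Fin d) ℂ) (b : Fin 2) :
    (discriminator U b).PosSemidef := by
  rw [discriminator_eq_sum]
  exact posSemidef_sum _ fun p _ => (posSemidef_single_self p).kronecker (posSemidef_bobEffect U p b)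

theorem discriminator_add (U : Fin N → unitaryGroup (Fin d) ℂ) :
    discriminator U 0 + discriminator U 1 = 1 := by
  rw [discriminator_eq_sum, discriminator_eq_sum, ← Finset.sum_add_distrib]
  have : ∀ p, Matrix.single p p (1 : ℂ) ⊗ₖ bobEffect U p 0 +
      Matrix.single p p (1 : ℂ) ⊗ₖ bobEffect U p 1 =
      Matrix.single p p (1 : ℂ) ⊗ₖ (1 : Matrix (Fin d) (Fin d) ℂ) := by
    intro p
    rw [← kronecker_add, ← sum_bobEffect U p, Fin.sum_univ_two]
  simp only [this]
  have h2 : ∀ s : Finset (Fin N × Fin 2), ∑ p ∈ s, Matrix.single p p (1 : ℂ) ⊗ₖ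
      (1 : Matrix (Fin d) (Fin d) ℂ) = (∑ p ∈ s, Matrix.single p p (1 : ℂ)) ⊗ₖ
        (1 : Matrix (Fin d) (Fin d) ℂ) := by
    intro s
    ext ⟨p, x⟩ ⟨q, y⟩
    simp only [Matrix.sum_apply, kroneckerMap_apply, Finset.sum_mul]
  rw [h2, sum_single_self, one_kronecker_one]

/-- Evaluation of a block-diagonal observable. -/
theorem trace_sum_single_kronecker_mul {Y Z : Type} [Fintype Y] [DecidableEq Y] [Fintype Z]
    (G : Y → Matrix Z Z ℂ) (M : Matrix (Y × Z) (Y × Z) ℂ) :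
    ((∑ p, Matrix.single p p (1 : ℂ) ⊗ₖ G p) * M).trace =
      ∑ p, (G p * Matrix.of fun z z' => M (p, z) (p, z')).trace := by
  rw [Finset.sum_mul, trace_sum]
  refine Finset.sum_congr rfl fun p _ => ?_
  simp only [Matrix.trace, diag_apply, mul_apply, kroneckerMap_apply, Fintype.sum_prod_type,
    Matrix.single_apply, of_apply]
  rw [Finset.sum_eq_single p]
  · refine Finset.sum_congr rfl fun z _ => ?_
    rw [Finset.sum_eq_single p]
    · simp
    · intro q _ hq; simp [Ne.symm hq]
    · simp
  · intro q _ hq; simp [Ne.symm hq]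
  · simp

theorem isDensity_maxEntangled (hd : 0 < d) : IsDensity (maxEntangled d) := by
  refine ⟨posSemidef_vecMulVec_self_star _, ?_⟩
  have hd' : (d : ℂ) ≠ 0 := by exact_mod_cast hd.ne'
  have h := one_div_sqrt_mul_self d
  simp only [maxEntangled, Matrix.trace, diag_apply, vecMulVec_apply, Fintype.sum_prod_type,
    Pi.star_apply, apply_ite star, Complex.star_def, Complex.conj_ofReal, star_zero, ite_mul,
    zero_mul, mul_ite, mul_zero, h]
  simp [hd']

/-- In this form each block at fixed Bob indices is a multiple of a matrix unit, the input on which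
the channel is then evaluated. -/
theorem maxEntangled_apply (x z x' z' : Fin d) :
    maxEntangled d (x, z) (x', z') = (1 / (d : ℂ)) * Matrix.single z z' 1 x x' := by
  have h := one_div_sqrt_mul_self d
  simp only [maxEntangled, vecMulVec_apply, Pi.star_apply, apply_ite star, Complex.star_def,
    Complex.conj_ofReal, map_zero, ite_mul, zero_mul, mul_ite, mul_zero, h, Matrix.single_apply]
  by_cases h1 : x = z <;> by_cases h2 : x' = z' <;> simp [h1, h2, eq_comm]

/-- The transpose trick: Bob's conditional state is proportional to the transpose of `U_j* Π_{y+a}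
U_j`. Since the `Π_c` are symmetric, transposing only conjugates `U_j`, which explains the conjugate
in Bob's procedure. -/
theorem tensorId_maxEntangled_block (U : Fin N → unitaryGroup (Fin d) ℂ) (a : Fin 2)
    (p : Fin N × Fin 2) :
    (Matrix.of fun z z' => tensorId (Fin d) (randomBinaryChannel U a) (maxEntangled d)
      (p, z) (p, z')) = (1 / (N : ℂ) * (1 / (d : ℂ))) • bobEffect U p a := by
  ext z z'
  have h : (Matrix.of fun x x' => maxEntangled d (x, z) (x', z')) =
      (1 / (d : ℂ)) • Matrix.single z z' (1 : ℂ) := by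
    ext x x'
    simp only [of_apply, maxEntangled_apply, Matrix.smul_apply, smul_eq_mul]
  have hQ : bobEffect U p a = ((U p.1 : Matrix (Fin d) (Fin d) ℂ)ᴴ * halfProj d (p.2 + a) *
      (U p.1 : Matrix (Fin d) (Fin d) ℂ))ᵀ := by
    rw [bobEffect, transpose_mul, transpose_mul, transpose_halfProj, ← mul_assoc]
    congr 2
    ext i j
    simp
  simp only [of_apply, tensorId, h, map_smul, Matrix.smul_apply, smul_eq_mul]
  rw [randomBinaryChannel_apply, diagonal_apply_eq, hQ, transpose_apply]
  have e : (halfProj d (p.2 + a) * ((U p.1 : Matrix (Fin d) (Fin d) ℂ) *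
      Matrix.single z z' 1 * (U p.1 : Matrix (Fin d) (Fin d) ℂ)ᴴ)).trace =
      ((U p.1 : Matrix (Fin d) (Fin d) ℂ)ᴴ * halfProj d (p.2 + a) *
      (U p.1 : Matrix (Fin d) (Fin d) ℂ)) z' z := by
    rw [← mul_assoc, trace_mul_comm, ← mul_assoc, ← mul_assoc, trace_mul_single]
    simp
  rw [e]
  ring

theorem hsInner_discriminator (hd : 0 < d) (hd2 : Even d) (hN : 0 < N)
    (U : Fin N → unitaryGroup (Fin d) ℂ) (a b : Fin 2) :
    hsInner (discriminator U b) (tensorId (Fin d) (randomBinaryChannel U a) (maxEntangled d)) =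
      if b = a then 1 else 0 := by
  have hd' : (d : ℂ) ≠ 0 := by exact_mod_cast hd.ne'
  have hN' : (N : ℂ) ≠ 0 := by exact_mod_cast hN.ne'
  rw [hsInner, (posSemidef_discriminator U b).1, discriminator_eq_sum,
    trace_sum_single_kronecker_mul]
  -- The two effects are equal or orthogonal projections. With rank `d / 2` and weight `1 / (N d)`,
  -- the `2 N` outcomes add up to `1`.
  have h : ∀ p, (bobEffect U p b * bobEffect U p a).trace = if b = a then (d : ℂ) / 2 else 0 := by
    intro p
    have : bobEffect U p b * bobEffect U p a = ((U p.1 : Matrix (Fin d) (Fin d) ℂ).map star)ᴴ *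
        ((halfProj d (p.2 + b) * halfProj d (p.2 + a)) *
        (U p.1 : Matrix (Fin d) (Fin d) ℂ).map star) := by
      rw [bobEffect, bobEffect]
      calc _ = ((U p.1 : Matrix (Fin d) (Fin d) ℂ).map star)ᴴ * (halfProj d (p.2 + b) *
          ((U p.1 : Matrix (Fin d) (Fin d) ℂ).map star *
            ((U p.1 : Matrix (Fin d) (Fin d) ℂ).map star)ᴴ) * halfProj d (p.2 + a) *
            (U p.1 : Matrix (Fin d) (Fin d) ℂ).map star) := by simp only [mul_assoc]
        _ = _ := by rw [map_star_mul_conjTranspose, mul_one]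
    rw [this, trace_mul_comm, mul_assoc, map_star_mul_conjTranspose, mul_one,
      halfProj_mul_halfProj]
    simp only [add_right_inj]
    split_ifs
    · exact trace_halfProj hd2 _
    · simp
  simp only [tensorId_maxEntangled_block, mul_smul_comm, trace_smul, h, smul_eq_mul]
  split_ifs
  · simp [Fintype.card_prod]
    field_simp
  · simp

end Channels

/-! ### The LOCC norm and the diamond norm -/

section LOCC

theorem sum_local_measurement {A A' B : Type} [Fintype A] [DecidableEq A] [Fintype A']
    [DecidableEq A'] [Fintype B] [DecidableEq B] {k : ℕ} (L : Fin k → Matrix A' A ℂ)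
    (hL : ∑ i, (L i)ᴴ * L i = 1) (M : Fin k → Fin 2 → Matrix A' A' ℂ)
    (hM : ∀ i, (∀ b, (M i b).PosSemidef) ∧ M i 0 + M i 1 = 1) :
    (∀ b, (∑ i, (L i)ᴴ * M i b * L i).PosSemidef) ∧
      ∑ i, (L i)ᴴ * M i 0 * L i + ∑ i, (L i)ᴴ * M i 1 * L i = 1 := by
  refine ⟨fun b => posSemidef_sum _ fun i _ => ((hM i).1 b).conjTranspose_mul_mul_same _, ?_⟩
  rw [← Finset.sum_add_distrib, ← hL]
  refine Finset.sum_congr rfl fun i _ => ?_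
  rw [← Matrix.add_mul, ← Matrix.mul_add, (hM i).2, Matrix.mul_one]

/-- Induction on the protocol; only this consequence of the LOCC structure enters the upper bound.
-/
theorem IsFiniteLOCC.measurement {A B : Type} [Fintype A] [DecidableEq A] [Fintype B]
    [DecidableEq B] {P : Fin 2 → Matrix (A × B) (A × B) ℂ} (h : IsFiniteLOCC P) :
    (∀ b, (P b).PosSemidef) ∧ P 0 + P 1 = 1 := by
  induction h with
  | announce c =>
    refine ⟨fun b => ?_, ?_⟩
    · dsimp only
      split_ifs
      exacts [PosSemidef.one, PosSemidef.zero]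
    · fin_cases c <;> simp
  | @alice A A' B _ _ _ _ _ _ k K hK M _ ih =>
    refine sum_local_measurement (B := B) (fun i => K i ⊗ₖ (1 : Matrix B B ℂ)) ?_ M ih
    have e : ∀ i, (K i ⊗ₖ (1 : Matrix B B ℂ))ᴴ * (K i ⊗ₖ (1 : Matrix B B ℂ)) =
        ((K i)ᴴ * K i) ⊗ₖ (1 : Matrix B B ℂ) := fun i => by
      rw [conjTranspose_kronecker, ← mul_kronecker_mul, conjTranspose_one, one_mul]
    simp only [e]
    rw [← one_kronecker_one, ← hK]
    ext ⟨p, x⟩ ⟨q, y⟩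
    simp only [Matrix.sum_apply, kroneckerMap_apply, Finset.sum_mul]
  | @bob A B B' _ _ _ _ _ _ k K hK M _ ih =>
    refine sum_local_measurement (B := B) (fun i => (1 : Matrix A A ℂ) ⊗ₖ K i) ?_ M ih
    have e : ∀ i, ((1 : Matrix A A ℂ) ⊗ₖ K i)ᴴ * ((1 : Matrix A A ℂ) ⊗ₖ K i) =
        (1 : Matrix A A ℂ) ⊗ₖ ((K i)ᴴ * K i) := fun i => by
      rw [conjTranspose_kronecker, ← mul_kronecker_mul, conjTranspose_one, one_mul]
    simp only [e]
    rw [← one_kronecker_one, ← hK]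
    ext ⟨p, x⟩ ⟨q, y⟩
    simp only [Matrix.sum_apply, kroneckerMap_apply, Finset.mul_sum]

/-- The bias is continuous in the measurement, so the bound for finitely many rounds extends to the
closure. -/
theorem re_hsInner_le_two_of_mem_loccMeasurements {A B : Type} [Fintype A] [DecidableEq A]
    [Fintype B] [DecidableEq B] {P : Fin 2 → Matrix (A × B) (A × B) ℂ}
    (hP : P ∈ loccMeasurements A B) {σ τ : Matrix (A × B) (A × B) ℂ} (hσ : IsDensity σ)
    (hτ : IsDensity τ) : (hsInner (P 0 - P 1) (σ - τ)).re ≤ 2 := by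
  have hc : Continuous fun P : Fin 2 → Matrix (A × B) (A × B) ℂ =>
      (hsInner (P 0 - P 1) (σ - τ)).re := by
    unfold hsInner
    refine Complex.continuous_re.comp (Continuous.matrix_trace (Continuous.matrix_mul
      (Continuous.matrix_conjTranspose ?_) continuous_const))
    fun_prop
  have hcl : IsClosed {P : Fin 2 → Matrix (A × B) (A × B) ℂ |
      (hsInner (P 0 - P 1) (σ - τ)).re ≤ 2} := isClosed_le hc continuous_const
  refine closure_minimal (fun Q hQ => ?_) hcl hP
  obtain ⟨h1, h2⟩ := IsFiniteLOCC.measurement hQ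
  have := re_trace_sub_mul_sub_le_two (h1 0) (h1 1) h2 hσ hτ
  rwa [Set.mem_ofPred_eq, hsInner, conjTranspose_sub, (h1 0).1, (h1 1).1]

variable {d N : ℕ}

/-- Alice measures in the standard basis, and then Bob performs a measurement that depends on the
result. -/
theorem isFiniteLOCC_of_standardBasis {Y Z : Type} [Fintype Y] [DecidableEq Y] [Fintype Z]
    [DecidableEq Z] (K : Y → Fin 2 → Matrix Z Z ℂ) (hK : ∀ p, ∑ b, (K p b)ᴴ * K p b = 1) :
    IsFiniteLOCC fun b => ∑ p, Matrix.single p p (1 : ℂ) ⊗ₖ ((K p b)ᴴ * K p b) := by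
  let e := (Fintype.equivFin Y).symm
  have hA : ∑ i, (Matrix.single (e i) (e i) (1 : ℂ))ᴴ * Matrix.single (e i) (e i) (1 : ℂ) = 1 := by
    simp only [conjTranspose_single, star_one, single_mul_single_same, mul_one]
    rw [Equiv.sum_comp e fun p => Matrix.single p p (1 : ℂ), sum_single_self]
  have h := IsFiniteLOCC.alice (B := Z) (fun i => Matrix.single (e i) (e i) (1 : ℂ)) hA _
    fun i => IsFiniteLOCC.bob (A := Y) (K (e i)) (hK (e i)) _ fun c => IsFiniteLOCC.announce c
  convert h using 2 with b
  rw [← Equiv.sum_comp e]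
  refine Finset.sum_congr rfl fun i _ => ?_
  -- Bob announces his own result `c`, so only the branch `c = b` contributes to outcome `b`.
  have hb : ∑ c, ((1 : Matrix Y Y ℂ) ⊗ₖ K (e i) c)ᴴ *
      (if b = c then (1 : Matrix (Y × Z) (Y × Z) ℂ) else 0) * ((1 : Matrix Y Y ℂ) ⊗ₖ K (e i) c) =
      (1 : Matrix Y Y ℂ) ⊗ₖ ((K (e i) b)ᴴ * K (e i) b) := by
    rw [Finset.sum_eq_single b]
    · rw [if_pos rfl, mul_one, conjTranspose_kronecker, ← mul_kronecker_mul, conjTranspose_one,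
        one_mul]
    · intro c _ hc
      rw [if_neg (Ne.symm hc), mul_zero, zero_mul]
    · simp
  rw [hb, conjTranspose_kronecker, ← mul_kronecker_mul, ← mul_kronecker_mul]
  simp

/-- Bob's Kraus operators on a space `ℂ^Z` into which `ℂ^d` is embedded by `J`. -/
def bobKraus {Z : Type} [DecidableEq Z] (J : Matrix Z (Fin d) ℂ)
    (U : Fin N → unitaryGroup (Fin d) ℂ) (p : Fin N × Fin 2) (b : Fin 2) : Matrix Z Z ℂ :=
  J * (halfProj d (p.2 + b) * (U p.1 : Matrix (Fin d) (Fin d) ℂ).map star) * Jᴴ +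
    -- The complement of the range of `J` is assigned to outcome `0`, an arbitrary choice that makes
    -- the measurement complete; the state used has no weight there.
    if b = 0 then 1 - J * Jᴴ else 0

/-- The projection `1 - J Jᴴ` annihilates the range of `J`, so both cross terms vanish. -/
theorem bobKraus_conjTranspose_mul {Z : Type} [Fintype Z] [DecidableEq Z]
    {J : Matrix Z (Fin d) ℂ} (hJ : Jᴴ * J = 1)
    (U : Fin N → unitaryGroup (Fin d) ℂ) (p : Fin N × Fin 2) (b : Fin 2) :
    (bobKraus J U p b)ᴴ * bobKraus J U p b =
      J * bobEffect U p b * Jᴴ + if b = 0 then 1 - J * Jᴴ else 0 := by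
  have h0 : Jᴴ * (1 - J * Jᴴ) = 0 := by
    rw [Matrix.mul_sub, ← Matrix.mul_assoc, hJ]; simp
  have h1 : (1 - J * Jᴴ) * J = 0 := by
    rw [Matrix.sub_mul, Matrix.mul_assoc, hJ]; simp
  have hh : (1 - J * Jᴴ)ᴴ = 1 - J * Jᴴ := by simp
  have hsq : (1 - J * Jᴴ) * (1 - J * Jᴴ) = 1 - J * Jᴴ := by
    rw [mul_sub, ← Matrix.mul_assoc, h1]; simp
  set W : Matrix (Fin d) (Fin d) ℂ :=
    halfProj d (p.2 + b) * (U p.1 : Matrix (Fin d) (Fin d) ℂ).map star with hW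
  have hWW : Wᴴ * W = bobEffect U p b := by
    rw [hW, conjTranspose_mul, conjTranspose_halfProj, bobEffect]
    rw [← mul_assoc, mul_assoc _ (halfProj d _) (halfProj d _), halfProj_mul_halfProj, if_pos rfl]
  have hmain : (J * W * Jᴴ)ᴴ * (J * W * Jᴴ) = J * bobEffect U p b * Jᴴ := by
    rw [← hWW]
    simp only [conjTranspose_mul, conjTranspose_conjTranspose]
    calc _ = J * (Wᴴ * (Jᴴ * J) * W) * Jᴴ := by simp only [Matrix.mul_assoc]
      _ = _ := by rw [hJ, mul_one]
  have hc1 : (J * W * Jᴴ)ᴴ * (1 - J * Jᴴ) = 0 := by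
    simp only [conjTranspose_mul, conjTranspose_conjTranspose]
    calc _ = J * Wᴴ * (Jᴴ * (1 - J * Jᴴ)) := by simp only [Matrix.mul_assoc]
      _ = 0 := by rw [h0, Matrix.mul_zero]
  have hc2 : (1 - J * Jᴴ) * (J * W * Jᴴ) = 0 := by
    calc _ = ((1 - J * Jᴴ) * J) * (W * Jᴴ) := by simp only [Matrix.mul_assoc]
      _ = 0 := by rw [h1, Matrix.zero_mul]
  rw [bobKraus, ← hW]
  split_ifs
  · rw [conjTranspose_add, add_mul, mul_add, mul_add, hmain, hc1, hh, hc2, hsq]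
    simp
  · rw [add_zero, hmain, add_zero]

theorem conj_discriminator {Z : Type} [Fintype Z] [DecidableEq Z]
    {J : Matrix Z (Fin d) ℂ} (hJ : Jᴴ * J = 1)
    (U : Fin N → unitaryGroup (Fin d) ℂ) (b : Fin 2) :
    ((1 : Matrix (Fin N × Fin 2) (Fin N × Fin 2) ℂ) ⊗ₖ J)ᴴ *
      (∑ p, Matrix.single p p (1 : ℂ) ⊗ₖ ((bobKraus J U p b)ᴴ * bobKraus J U p b)) *
      ((1 : Matrix (Fin N × Fin 2) (Fin N × Fin 2) ℂ) ⊗ₖ J) = discriminator U b := by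
  rw [discriminator_eq_sum, Matrix.mul_sum, Matrix.sum_mul]
  refine Finset.sum_congr rfl fun p _ => ?_
  rw [conjTranspose_kronecker, ← mul_kronecker_mul, ← mul_kronecker_mul, conjTranspose_one, one_mul,
    mul_one, bobKraus_conjTranspose_mul hJ]
  congr 1
  have h0 : Jᴴ * (1 - J * Jᴴ) = 0 := by
    rw [Matrix.mul_sub, ← Matrix.mul_assoc, hJ]; simp
  have h2 : Jᴴ * (if b = 0 then 1 - J * Jᴴ else 0) = 0 := by
    split_ifs
    · exact h0
    · simp
  rw [Matrix.mul_add, h2, add_zero]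
  calc _ = (Jᴴ * J) * bobEffect U p b * (Jᴴ * J) := by simp only [Matrix.mul_assoc]
    _ = _ := by rw [hJ, one_mul, mul_one]

theorem hsInner_discriminator_sub (hd : 0 < d) (hd2 : Even d) (hN : 0 < N)
    (U : Fin N → unitaryGroup (Fin d) ℂ) :
    hsInner (discriminator U 0 - discriminator U 1)
      (tensorId (Fin d) (randomBinaryChannel U 0 - randomBinaryChannel U 1) (maxEntangled d)) =
      2 := by
  have h := hsInner_discriminator hd hd2 hN U
  have h00 := h 0 0
  have h01 := h 0 1
  have h10 := h 1 0
  have h11 := h 1 1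
  simp only [hsInner, if_true, zero_ne_one, one_ne_zero, if_false] at h00 h01 h10 h11
  rw [hsInner, tensorId_sub, conjTranspose_sub, sub_mul, mul_sub, mul_sub, trace_sub, trace_sub,
    trace_sub, h00, h01, h10, h11]
  norm_num

theorem exists_isometry_of_card_le {Z : Type} [Fintype Z] [DecidableEq Z]
    (h : d ≤ Fintype.card Z) : ∃ J : Matrix Z (Fin d) ℂ, Jᴴ * J = 1 := by
  obtain ⟨f⟩ : Nonempty (Fin d ↪ Z) := Function.Embedding.nonempty_of_card_le (by simpa using h)
  refine ⟨Matrix.of fun z i => if z = f i then 1 else 0, ?_⟩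
  ext i j
  simp only [mul_apply, conjTranspose_apply, of_apply, apply_ite star, star_one, star_zero,
    Matrix.one_apply, ite_mul, one_mul, zero_mul, Finset.sum_ite_eq', Finset.mem_univ, if_true,
    f.injective.eq_iff]

theorem loccNorm_eq_two (hd : 0 < d) (hd2 : Even d) (hN : 0 < N)
    (U : Fin N → unitaryGroup (Fin d) ℂ) (Z : Type) [Fintype Z] [DecidableEq Z]
    (hZ : d ≤ Fintype.card Z) :
    loccNorm Z (randomBinaryChannel U 0 - randomBinaryChannel U 1) = 2 := by
  refine IsGreatest.csSup_eq ⟨?_, ?_⟩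
  · obtain ⟨J, hJ⟩ := exists_isometry_of_card_le hZ
    have hJ1 : ((1 : Matrix (Fin d) (Fin d) ℂ) ⊗ₖ J)ᴴ * ((1 : Matrix (Fin d) (Fin d) ℂ) ⊗ₖ J) = 1 := by
      rw [conjTranspose_kronecker, ← mul_kronecker_mul, hJ, conjTranspose_one, one_mul,
        one_kronecker_one]
    have hm := isDensity_maxEntangled hd
    refine ⟨fun b => ∑ p, Matrix.single p p (1 : ℂ) ⊗ₖ ((bobKraus J U p b)ᴴ * bobKraus J U p b),
      subset_closure (isFiniteLOCC_of_standardBasis _ fun p => ?_),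
      ((1 : Matrix (Fin d) (Fin d) ℂ) ⊗ₖ J) * maxEntangled d *
        ((1 : Matrix (Fin d) (Fin d) ℂ) ⊗ₖ J)ᴴ, ⟨hm.1.mul_mul_conjTranspose_same _, ?_⟩, ?_⟩
    · rw [Fin.sum_univ_two, bobKraus_conjTranspose_mul hJ, bobKraus_conjTranspose_mul hJ,
        if_pos rfl, if_neg one_ne_zero]
      have := sum_bobEffect U p
      rw [Fin.sum_univ_two] at this
      rw [add_zero, add_right_comm, ← Matrix.add_mul, ← Matrix.mul_add, this, Matrix.mul_one]
      simp
    · rw [trace_mul_comm, ← Matrix.mul_assoc, hJ1, one_mul, hm.2]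
    · have h := hsInner_discriminator_sub hd hd2 hN U
      dsimp only
      rw [tensorId_sub, tensorId_conj _ (randomBinaryChannel_eq_sum U 0),
        tensorId_conj _ (randomBinaryChannel_eq_sum U 1), ← Matrix.sub_mul, ← Matrix.mul_sub,
        ← tensorId_sub, hsInner, ← Matrix.mul_assoc, trace_mul_comm, ← Matrix.mul_assoc,
        ← Matrix.mul_assoc, ← conjTranspose_conjTranspose ((1 : Matrix _ _ ℂ) ⊗ₖ J)ᴴ]
      -- `hsInner` takes the adjoint of its first argument, which has to be pulled outside the
      -- compression by `1 ⊗ J`.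
      have e : ∀ (S : Matrix ((Fin N × Fin 2) × Z) ((Fin N × Fin 2) × Fin d) ℂ)
          (P : Matrix ((Fin N × Fin 2) × Z) ((Fin N × Fin 2) × Z) ℂ),
          Sᴴ * Pᴴ * S = (Sᴴ * P * S)ᴴ := fun S P => by
        simp [conjTranspose_mul, Matrix.mul_assoc]
      rw [conjTranspose_conjTranspose, e, Matrix.mul_sub, Matrix.sub_mul, conj_discriminator hJ,
        conj_discriminator hJ]
      rw [hsInner] at h
      rw [h]
      simp
  · rintro r ⟨P, hP, ρ, hρ, rfl⟩
    rw [tensorId_sub]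
    exact re_hsInner_le_two_of_mem_loccMeasurements hP (isDensity_tensorId hN U 0 hρ)
      (isDensity_tensorId hN U 1 hρ)

theorem diamondNorm_eq_two (hd : 0 < d) (hd2 : Even d) (hN : 0 < N)
    (U : Fin N → unitaryGroup (Fin d) ℂ) :
    diamondNorm (randomBinaryChannel U 0 - randomBinaryChannel U 1) = 2 := by
  have hm := isDensity_maxEntangled hd
  have hle : ∀ ρ : Matrix (Fin d × Fin d) (Fin d × Fin d) ℂ, IsDensity ρ → traceNorm
      (tensorId (Fin d) (randomBinaryChannel U 0 - randomBinaryChannel U 1) ρ) ≤ 2 := by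
    intro ρ hρ
    rw [tensorId_sub]
    exact traceNorm_sub_le_two (isDensity_tensorId hN U 0 hρ) (isDensity_tensorId hN U 1 hρ)
  refine IsGreatest.csSup_eq ⟨⟨maxEntangled d, hm, le_antisymm ?_ (hle _ hm)⟩, ?_⟩
  · have h := hsInner_discriminator_sub hd hd2 hN U
    rw [hsInner, conjTranspose_sub, (posSemidef_discriminator U 0).1,
      (posSemidef_discriminator U 1).1] at h
    have h2 := re_trace_sub_mul_le_traceNorm (posSemidef_discriminator U 0)
      (posSemidef_discriminator U 1) (discriminator_add U)
      (A := tensorId (Fin d) (randomBinaryChannel U 0 - randomBinaryChannel U 1) (maxEntangled d))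
      (by
        rw [tensorId_sub]
        exact (isDensity_tensorId hN U 0 hm).1.1.sub (isDensity_tensorId hN U 1 hm).1.1)
    rw [h] at h2
    simpa using h2
  · rintro r ⟨ρ, hρ, rfl⟩
    exact hle ρ hρ

end LOCC

/-! ### Gaussian integrals -/

section Gaussian

theorem integral_pow_mul_exp_neg_sq (j : ℕ) :
    ∫ r in Set.Ioi (0 : ℝ), r ^ (2 * j + 1) * Real.exp (-r ^ 2) = (j.factorial : ℝ) / 2 := by
  have h := integral_rpow_mul_exp_neg_rpow (p := 2) (q := (2 * j + 1 : ℕ)) two_pos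
    (by have : (0 : ℝ) ≤ ((2 * j + 1 : ℕ) : ℝ) := Nat.cast_nonneg _
        linarith)
  have e : (((2 * j + 1 : ℕ) : ℝ) + 1) / 2 = (j : ℝ) + 1 := by push_cast; ring
  rw [e, Real.Gamma_nat_eq_factorial] at h
  simp only [Real.rpow_natCast, Real.rpow_two] at h
  rw [h]
  ring

theorem integrableOn_pow_mul_exp_neg_sq (m : ℕ) :
    IntegrableOn (fun r : ℝ => r ^ m * Real.exp (-r ^ 2)) (Set.Ioi 0) := by
  have h := integrableOn_rpow_mul_exp_neg_mul_sq (b := 1) one_pos (s := (m : ℝ))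
    (by have : (0 : ℝ) ≤ (m : ℝ) := Nat.cast_nonneg _
        linarith)
  simpa using h

/-- Without the absolute value the integrand is the derivative of `(cos θ sin θ)^(k+1) / (k+1)`. The
sign changes at `π/4`, where `cos θ sin θ = 1/2`, and the two halves contribute equally. -/
theorem integral_angle (k : ℕ) :
    ∫ θ in Set.Ioo (0 : ℝ) (Real.pi / 2),
      (Real.cos θ * Real.sin θ) ^ k * |Real.cos θ ^ 2 - Real.sin θ ^ 2| =
      2 * (1 / 2) ^ (k + 1) / (k + 1) := by
  have hpi := Real.pi_pos
  rw [← integral_Ioc_eq_integral_Ioo, ← intervalIntegral.integral_of_le (by positivity)]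
  have hd : ∀ θ : ℝ, HasDerivAt
      (fun θ => (Real.cos θ * Real.sin θ) ^ (k + 1) / (k + 1))
      ((Real.cos θ * Real.sin θ) ^ k * (Real.cos θ ^ 2 - Real.sin θ ^ 2)) θ := by
    intro θ
    have h1 := (((Real.hasDerivAt_cos θ).mul (Real.hasDerivAt_sin θ)).pow (k + 1)).div_const
      ((k : ℝ) + 1)
    have hk : (k : ℝ) + 1 ≠ 0 := by positivity
    refine h1.congr_deriv ?_
    simp only [Pi.mul_apply, Nat.add_sub_cancel]
    push_cast
    field_simp
    ring
  have hint : ∀ f : ℝ → ℝ, Continuous f → ∀ a b, IntervalIntegrable f volume a b :=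
    fun f hf a b => hf.intervalIntegrable a b
  have hc : Continuous fun θ : ℝ =>
      (Real.cos θ * Real.sin θ) ^ k * |Real.cos θ ^ 2 - Real.sin θ ^ 2| := by fun_prop
  have hc' : Continuous fun θ : ℝ =>
      (Real.cos θ * Real.sin θ) ^ k * (Real.cos θ ^ 2 - Real.sin θ ^ 2) := by fun_prop
  have hF : ∀ a b : ℝ, ∫ θ in a..b,
      (Real.cos θ * Real.sin θ) ^ k * (Real.cos θ ^ 2 - Real.sin θ ^ 2) =
      (Real.cos b * Real.sin b) ^ (k + 1) / (k + 1) -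
        (Real.cos a * Real.sin a) ^ (k + 1) / (k + 1) := fun a b =>
    intervalIntegral.integral_eq_sub_of_hasDerivAt (fun θ _ => hd θ) (hint _ hc' a b)
  have h4 : Real.cos (Real.pi / 4) * Real.sin (Real.pi / 4) = 1 / 2 := by
    rw [Real.cos_pi_div_four, Real.sin_pi_div_four]
    nlinarith [Real.sq_sqrt (show (0 : ℝ) ≤ 2 by norm_num)]
  rw [← intervalIntegral.integral_add_adjacent_intervals (hint _ hc 0 (Real.pi / 4))
    (hint _ hc (Real.pi / 4) (Real.pi / 2))]
  have h1 : ∫ θ in (0 : ℝ)..(Real.pi / 4),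
      (Real.cos θ * Real.sin θ) ^ k * |Real.cos θ ^ 2 - Real.sin θ ^ 2| =
      (1 / 2) ^ (k + 1) / (k + 1) := by
    rw [intervalIntegral.integral_congr (g := fun θ : ℝ =>
      (Real.cos θ * Real.sin θ) ^ k * (Real.cos θ ^ 2 - Real.sin θ ^ 2)), hF, h4]
    · simp
    · intro θ hθ
      rw [Set.uIcc_of_le (by positivity)] at hθ
      dsimp only
      rw [abs_of_nonneg]
      rw [← Real.cos_two_mul']
      exact Real.cos_nonneg_of_mem_Icc ⟨by linarith [hθ.1], by linarith [hθ.2]⟩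
  have h2 : ∫ θ in (Real.pi / 4)..(Real.pi / 2),
      (Real.cos θ * Real.sin θ) ^ k * |Real.cos θ ^ 2 - Real.sin θ ^ 2| =
      (1 / 2) ^ (k + 1) / (k + 1) := by
    rw [intervalIntegral.integral_congr (g := fun θ : ℝ =>
      -((Real.cos θ * Real.sin θ) ^ k * (Real.cos θ ^ 2 - Real.sin θ ^ 2))),
      intervalIntegral.integral_neg, hF, h4]
    · simp
    · intro θ hθ
      rw [Set.uIcc_of_le (by linarith)] at hθ
      dsimp only
      rw [abs_of_nonpos, mul_neg]
      rw [← Real.cos_two_mul']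
      exact Real.cos_nonpos_of_pi_div_two_le_of_le (by linarith [hθ.1]) (by linarith [hθ.2])
  rw [h1, h2]
  ring

theorem cos_pos_and_sin_pos_iff {θ : ℝ} (h1 : -Real.pi < θ) (h2 : θ < Real.pi) :
    (0 < Real.cos θ ∧ 0 < Real.sin θ) ↔ 0 < θ ∧ θ < Real.pi / 2 := by
  have hpi := Real.pi_pos
  refine ⟨fun ⟨hc, hs⟩ => ⟨?_, ?_⟩, fun ⟨h3, h4⟩ =>
    ⟨Real.cos_pos_of_mem_Ioo ⟨by linarith, h4⟩, Real.sin_pos_of_pos_of_lt_pi h3 h2⟩⟩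
  · by_contra h
    exact absurd hs (not_lt.mpr (Real.sin_nonpos_of_nonpos_of_neg_pi_le (not_lt.mp h) h1.le))
  · by_contra h
    exact absurd hc (not_lt.mpr
      (Real.cos_nonpos_of_pi_div_two_le_of_le (not_lt.mp h) (by linarith)))

/-- Polar coordinates: the radial exponent `2k + 3` collects `2k` from the powers, `2` from the
difference of squares and `1` from the Jacobian. -/
theorem integral_quadrant (k : ℕ) :
    ∫ z in Set.Ioi (0 : ℝ) ×ˢ Set.Ioi (0 : ℝ),
      z.1 ^ k * z.2 ^ k * (|z.1 ^ 2 - z.2 ^ 2| * Real.exp (-(z.1 ^ 2 + z.2 ^ 2))) =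
    (∫ r in Set.Ioi (0 : ℝ), r ^ (2 * k + 3) * Real.exp (-r ^ 2)) *
      (2 * (1 / 2) ^ (k + 1) / (k + 1)) := by
  have hm : MeasurableSet (Set.Ioi (0 : ℝ) ×ˢ Set.Ioi (0 : ℝ)) :=
    measurableSet_Ioi.prod measurableSet_Ioi
  have hm' : MeasurableSet (Set.Ioi (0 : ℝ) ×ˢ Set.Ioo (0 : ℝ) (Real.pi / 2)) :=
    measurableSet_Ioi.prod measurableSet_Ioo
  have hsub : Set.Ioi (0 : ℝ) ×ˢ Set.Ioo (0 : ℝ) (Real.pi / 2) ⊆ polarCoord.target := by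
    rintro ⟨r, θ⟩ ⟨hr, hθ⟩
    exact ⟨hr, by linarith [Real.pi_pos, hθ.1], by linarith [Real.pi_pos, hθ.2]⟩
  rw [← integral_indicator hm, ← integral_comp_polarCoord_symm, ← integral_angle,
    ← setIntegral_prod_mul, ← Measure.volume_eq_prod, ← Set.inter_eq_self_of_subset_right hsub,
    ← setIntegral_indicator hm']
  refine setIntegral_congr_fun polarCoord.open_target.measurableSet ?_
  rintro ⟨r, θ⟩ ⟨hr, hθ⟩
  have hr' : 0 < r := hr
  dsimp only
  rw [polarCoord_symm_apply]
  by_cases h : 0 < θ ∧ θ < Real.pi / 2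
  · have h' := (cos_pos_and_sin_pos_iff hθ.1 hθ.2).mpr h
    rw [Set.indicator_of_mem, Set.indicator_of_mem]
    · have e1 : (r * Real.cos θ) ^ 2 - (r * Real.sin θ) ^ 2 =
          r ^ 2 * (Real.cos θ ^ 2 - Real.sin θ ^ 2) := by ring
      have e2 : (r * Real.cos θ) ^ 2 + (r * Real.sin θ) ^ 2 = r ^ 2 := by
        rw [mul_pow, mul_pow, ← mul_add, Real.cos_sq_add_sin_sq, mul_one]
      dsimp only
      rw [e1, e2, abs_mul, abs_of_nonneg (sq_nonneg r), smul_eq_mul]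
      ring
    · exact ⟨hr, h⟩
    · exact ⟨mul_pos hr' h'.1, mul_pos hr' h'.2⟩
  · rw [Set.indicator_of_notMem, Set.indicator_of_notMem, smul_zero]
    · exact fun hh => h hh.2
    · intro hh
      refine h ((cos_pos_and_sin_pos_iff hθ.1 hθ.2).mp ⟨?_, ?_⟩)
      · exact (mul_pos_iff_of_pos_left hr').mp hh.1
      · exact (mul_pos_iff_of_pos_left hr').mp hh.2

variable {E : Type} [NormedAddCommGroup E] [NormedSpace ℝ E] [FiniteDimensional ℝ E]
  [MeasurableSpace E] [BorelSpace E] (μ : Measure E) [μ.IsAddHaarMeasure]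

theorem integrable_norm_pow_mul_exp_neg_sq [Nontrivial E] (m : ℕ) :
    Integrable (fun x : E => ‖x‖ ^ m * Real.exp (-‖x‖ ^ 2)) μ := by
  rw [integrable_fun_norm_addHaar μ (f := fun r : ℝ => r ^ m * Real.exp (-r ^ 2))]
  refine (integrableOn_pow_mul_exp_neg_sq (Module.finrank ℝ E - 1 + m)).congr_fun ?_
    measurableSet_Ioi
  intro r _
  simp only [smul_eq_mul, pow_add, mul_assoc]

/-- `x ↦ (‖x₁‖² + ‖x₂‖²) exp (-(‖x₁‖² + ‖x₂‖²))` as a sum of products. -/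
theorem sq_add_sq_mul_exp_eq (a b : ℝ) : (a ^ 2 + b ^ 2) * Real.exp (-(a ^ 2 + b ^ 2)) =
    (a ^ 2 * Real.exp (-a ^ 2)) * (b ^ 0 * Real.exp (-b ^ 2)) +
      (a ^ 0 * Real.exp (-a ^ 2)) * (b ^ 2 * Real.exp (-b ^ 2)) := by
  rw [neg_add, Real.exp_add]
  ring

theorem integrable_sq_add_sq_mul_exp [Nontrivial E] :
    Integrable (fun w : E × E => (‖w.1‖ ^ 2 + ‖w.2‖ ^ 2) *
      Real.exp (-(‖w.1‖ ^ 2 + ‖w.2‖ ^ 2))) (μ.prod μ) := by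
  simp only [sq_add_sq_mul_exp_eq]
  exact ((integrable_norm_pow_mul_exp_neg_sq μ 2).mul_prod
    (integrable_norm_pow_mul_exp_neg_sq μ 0)).add ((integrable_norm_pow_mul_exp_neg_sq μ 0).mul_prod
    (integrable_norm_pow_mul_exp_neg_sq μ 2))

/-- The first factor is the area of the unit sphere. As the real dimension is even, the radial
exponent `2(j+i)+1` is odd and the Gamma value is a factorial. -/
theorem integral_norm_pow_mul_exp [Nontrivial E] {j : ℕ}
    (hE : Module.finrank ℝ E = 2 * (j + 1)) (i : ℕ) :
    ∫ x : E, ‖x‖ ^ (2 * i) * Real.exp (-‖x‖ ^ 2) ∂μ =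
      (2 * (j + 1 : ℕ) * μ.real (Metric.ball 0 1)) * (((j + i).factorial : ℝ) / 2) := by
  rw [integral_fun_norm_addHaar μ (fun r : ℝ => r ^ (2 * i) * Real.exp (-r ^ 2)), hE,
    ← integral_pow_mul_exp_neg_sq, nsmul_eq_mul, smul_eq_mul, ← mul_assoc]
  congr 1
  · push_cast; ring
  · refine setIntegral_congr_fun measurableSet_Ioi fun r _ => ?_
    simp only [smul_eq_mul]
    rw [← mul_assoc, ← pow_add]
    congr 2
    omega

theorem integral_sq_add_sq_mul_exp [Nontrivial E] {j : ℕ}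
    (hE : Module.finrank ℝ E = 2 * (j + 1)) :
    ∫ w : E × E, (‖w.1‖ ^ 2 + ‖w.2‖ ^ 2) * Real.exp (-(‖w.1‖ ^ 2 + ‖w.2‖ ^ 2)) ∂(μ.prod μ) =
      (2 * (j + 1 : ℕ) * μ.real (Metric.ball 0 1)) ^ 2 *
        ((j.factorial : ℝ) * ((j + 1).factorial : ℝ) / 2) := by
  have h0 := integral_norm_pow_mul_exp μ hE 0
  have h2 := integral_norm_pow_mul_exp μ hE 1
  simp only [sq_add_sq_mul_exp_eq]
  rw [integral_add ((integrable_norm_pow_mul_exp_neg_sq μ 2).mul_prod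
    (integrable_norm_pow_mul_exp_neg_sq μ 0)) ((integrable_norm_pow_mul_exp_neg_sq μ 0).mul_prod
    (integrable_norm_pow_mul_exp_neg_sq μ 2)),
    integral_prod_mul (fun x : E => ‖x‖ ^ 2 * Real.exp (-‖x‖ ^ 2))
      (fun x : E => ‖x‖ ^ 0 * Real.exp (-‖x‖ ^ 2)),
    integral_prod_mul (fun x : E => ‖x‖ ^ 0 * Real.exp (-‖x‖ ^ 2))
      (fun x : E => ‖x‖ ^ 2 * Real.exp (-‖x‖ ^ 2))]
  simp only [mul_zero, mul_one, add_zero] at h0 h2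
  rw [h0, h2]
  ring

theorem abs_sq_sub_sq_le (a b : ℝ) : |a ^ 2 - b ^ 2| ≤ a ^ 2 + b ^ 2 :=
  abs_le.mpr ⟨by nlinarith [sq_nonneg a], by nlinarith [sq_nonneg b]⟩

theorem integrable_abs_sq_sub_sq_mul_exp [Nontrivial E] :
    Integrable (fun w : E × E => |‖w.1‖ ^ 2 - ‖w.2‖ ^ 2| *
      Real.exp (-(‖w.1‖ ^ 2 + ‖w.2‖ ^ 2))) (μ.prod μ) := by
  refine (integrable_sq_add_sq_mul_exp μ).mono' ?_ (ae_of_all _ fun w => ?_)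
  · exact (by fun_prop : Continuous fun w : E × E => |‖w.1‖ ^ 2 - ‖w.2‖ ^ 2| *
      Real.exp (-(‖w.1‖ ^ 2 + ‖w.2‖ ^ 2))).aestronglyMeasurable
  · rw [norm_mul, Real.norm_eq_abs, Real.norm_eq_abs, abs_abs, Real.abs_exp]
    gcongr
    exact abs_sq_sub_sq_le _ _

theorem integrableOn_quadrant (k : ℕ) : IntegrableOn (fun z : ℝ × ℝ => z.1 ^ k * z.2 ^ k *
    (|z.1 ^ 2 - z.2 ^ 2| * Real.exp (-(z.1 ^ 2 + z.2 ^ 2))))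
    (Set.Ioi (0 : ℝ) ×ˢ Set.Ioi (0 : ℝ)) := by
  have hk := integrableOn_pow_mul_exp_neg_sq k
  have hk2 := integrableOn_pow_mul_exp_neg_sq (k + 2)
  have hi := (hk2.mul_prod hk).add (hk.mul_prod hk2)
  rw [Measure.prod_restrict, ← Measure.volume_eq_prod] at hi
  refine Integrable.mono' hi ?_ ?_
  · exact (by fun_prop : Continuous fun z : ℝ × ℝ => z.1 ^ k * z.2 ^ k *
      (|z.1 ^ 2 - z.2 ^ 2| * Real.exp (-(z.1 ^ 2 + z.2 ^ 2)))).aestronglyMeasurable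
  · refine (ae_restrict_iff' (measurableSet_Ioi.prod measurableSet_Ioi)).mpr
      (ae_of_all _ fun z hz => ?_)
    have h1 : 0 < z.1 := hz.1
    have h2 : 0 < z.2 := hz.2
    rw [norm_mul, norm_mul, norm_mul, norm_pow, norm_pow, Real.norm_eq_abs, Real.norm_eq_abs,
      Real.norm_eq_abs, Real.norm_eq_abs, abs_abs, Real.abs_exp, abs_of_pos h1, abs_of_pos h2]
    calc _ ≤ z.1 ^ k * z.2 ^ k * ((z.1 ^ 2 + z.2 ^ 2) * Real.exp (-(z.1 ^ 2 + z.2 ^ 2))) := by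
          gcongr
          exact abs_sq_sub_sq_le _ _
      _ = _ := by
          rw [sq_add_sq_mul_exp_eq]
          simp only [Pi.add_apply]
          ring

/-- Radial integration in each factor gives the density `r^(2j+1) s^(2j+1)` on the quadrant, the
case `k = 2j + 1` of `integral_quadrant`. -/
theorem integral_abs_sq_sub_sq_mul_exp [Nontrivial E] {j : ℕ}
    (hE : Module.finrank ℝ E = 2 * (j + 1)) :
    ∫ w : E × E, |‖w.1‖ ^ 2 - ‖w.2‖ ^ 2| * Real.exp (-(‖w.1‖ ^ 2 + ‖w.2‖ ^ 2)) ∂(μ.prod μ) =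
      (2 * (j + 1 : ℕ) * μ.real (Metric.ball 0 1)) ^ 2 *
        (((2 * (j + 1)).factorial : ℝ) / 2 * ((1 / 4) ^ (j + 1) / (j + 1 : ℕ))) := by
  have hq := integral_quadrant (2 * j + 1)
  have e3 : 2 * (2 * j + 1) + 3 = 2 * (2 * (j + 1)) + 1 := by ring
  rw [e3, integral_pow_mul_exp_neg_sq] at hq
  rw [integral_prod _ (integrable_abs_sq_sub_sq_mul_exp μ)]
  have h1 : ∀ x : E, ∫ y : E, |‖x‖ ^ 2 - ‖y‖ ^ 2| * Real.exp (-(‖x‖ ^ 2 + ‖y‖ ^ 2)) ∂μ =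
      (2 * (j + 1 : ℕ) * μ.real (Metric.ball 0 1)) * ∫ s in Set.Ioi (0 : ℝ), s ^ (2 * j + 1) *
        (|‖x‖ ^ 2 - s ^ 2| * Real.exp (-(‖x‖ ^ 2 + s ^ 2))) := by
    intro x
    rw [integral_fun_norm_addHaar μ (fun s : ℝ => |‖x‖ ^ 2 - s ^ 2| *
      Real.exp (-(‖x‖ ^ 2 + s ^ 2))), hE, nsmul_eq_mul, smul_eq_mul, ← mul_assoc]
    push_cast
    rfl
  simp only [h1]
  rw [integral_const_mul, integral_fun_norm_addHaar μ (fun r : ℝ =>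
    ∫ s in Set.Ioi (0 : ℝ), s ^ (2 * j + 1) * (|r ^ 2 - s ^ 2| * Real.exp (-(r ^ 2 + s ^ 2)))),
    hE, nsmul_eq_mul, smul_eq_mul]
  have h2 : ∫ r in Set.Ioi (0 : ℝ), r ^ (2 * (j + 1) - 1) • ∫ s in Set.Ioi (0 : ℝ),
      s ^ (2 * j + 1) * (|r ^ 2 - s ^ 2| * Real.exp (-(r ^ 2 + s ^ 2))) =
      ((2 * (j + 1)).factorial : ℝ) / 2 * ((1 / 4) ^ (j + 1) / (j + 1 : ℕ)) := by
    rw [Measure.volume_eq_prod, setIntegral_prod _ (by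
      rw [← Measure.volume_eq_prod]; exact integrableOn_quadrant _)] at hq
    have e : (2 * (1 / 2 : ℝ) ^ (2 * j + 1 + 1) / ((2 * j + 1 : ℕ) + 1)) =
        (1 / 4) ^ (j + 1) / (j + 1 : ℕ) := by
      rw [show 2 * j + 1 + 1 = 2 * (j + 1) by ring, pow_mul]
      have : ((j : ℝ) + 1) ≠ 0 := by positivity
      push_cast
      field_simp
      ring_nf
    rw [e] at hq
    rw [← hq]
    refine setIntegral_congr_fun measurableSet_Ioi fun r _ => ?_
    simp only [smul_eq_mul]
    rw [← integral_const_mul]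
    refine setIntegral_congr_fun measurableSet_Ioi fun s _ => ?_
    simp only [← mul_assoc]
    rfl
  rw [h2]
  push_cast
  ring

end Gaussian

/-! ### The mean bias of a Haar-random measurement -/

section MeanBias

/-- The squared Euclidean norm of a vector. -/
def sqSum {ι : Type} [Fintype ι] (w : ι → ℂ) : ℝ := ∑ i, ‖w i‖ ^ 2

/-- `|‖Π₀ w‖² - ‖Π₁ w‖²|`. -/
def bias {d : ℕ} (w : Fin d → ℂ) : ℝ :=
  |∑ i : Fin d, (if (i : ℕ) < d / 2 then (1 : ℝ) else -1) * ‖w i‖ ^ 2|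

theorem sqSum_nonneg {ι : Type} [Fintype ι] (w : ι → ℂ) : 0 ≤ sqSum w :=
  Finset.sum_nonneg fun _ _ => sq_nonneg _

theorem ofReal_sqSum {ι : Type} [Fintype ι] (w : ι → ℂ) : (sqSum w : ℂ) = star w ⬝ᵥ w := by
  simp only [sqSum, dotProduct, Pi.star_apply, Complex.star_def, Complex.conj_mul']
  push_cast
  rfl

theorem sqSum_eq_zero {ι : Type} [Fintype ι] {w : ι → ℂ} (h : sqSum w = 0) : w = 0 := by
  funext i
  have := (Finset.sum_eq_zero_iff_of_nonneg fun i _ => sq_nonneg ‖w i‖).mp h i (Finset.mem_univ i)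
  simpa using this

theorem sqSum_smul {ι : Type} [Fintype ι] (c : ℂ) (w : ι → ℂ) :
    sqSum (c • w) = ‖c‖ ^ 2 * sqSum w := by
  simp only [sqSum, Finset.mul_sum, Pi.smul_apply, smul_eq_mul, norm_mul, mul_pow]

theorem sqSum_mulVec {d : ℕ} (V : unitaryGroup (Fin d) ℂ) (w : Fin d → ℂ) :
    sqSum ((V : Matrix (Fin d) (Fin d) ℂ) *ᵥ w) = sqSum w := by
  apply Complex.ofReal_injective
  rw [ofReal_sqSum, ofReal_sqSum, star_mulVec, dotProduct_mulVec, vecMul_vecMul,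
    unitary_conjTranspose_mul, vecMul_one]

theorem bias_le_sqSum {d : ℕ} (w : Fin d → ℂ) : bias w ≤ sqSum w := by
  refine (Finset.abs_sum_le_sum_abs _ _).trans (Finset.sum_le_sum fun i _ => ?_)
  rw [abs_mul, abs_of_nonneg (sq_nonneg ‖w i‖)]
  split_ifs <;> simp

theorem bias_smul {d : ℕ} (c : ℂ) (w : Fin d → ℂ) : bias (c • w) = ‖c‖ ^ 2 * bias w := by
  rw [bias, bias]
  conv_rhs => rw [← abs_of_nonneg (sq_nonneg ‖c‖), ← abs_mul, Finset.mul_sum]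
  congr 1
  refine Finset.sum_congr rfl fun i _ => ?_
  rw [Pi.smul_apply, smul_eq_mul, norm_mul]
  ring

theorem continuous_bias {d : ℕ} : Continuous (bias (d := d)) := by
  unfold bias
  fun_prop

theorem bias_nonneg {d : ℕ} (w : Fin d → ℂ) : 0 ≤ bias w := abs_nonneg _

/-- A linear automorphism that fixes a set of positive finite volume preserves the volume. -/
theorem measurePreserving_of_image_eq {F : Type} [NormedAddCommGroup F] [NormedSpace ℝ F]
    [FiniteDimensional ℝ F] [MeasurableSpace F] [BorelSpace F] (μ : Measure F)
    [μ.IsAddHaarMeasure] (A : F →ₗ[ℝ] F) {S : Set F} (hAS : A '' S = S) (h0 : μ S ≠ 0)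
    (hfin : μ S ≠ ⊤) : MeasurePreserving A μ μ := by
  have h := Measure.addHaar_image_linearMap μ A S
  rw [hAS] at h
  have hdet : ENNReal.ofReal |LinearMap.det A| = 1 := by
    have h' : 1 * μ S = ENNReal.ofReal |LinearMap.det A| * μ S := by rw [one_mul]; exact h
    exact ((ENNReal.mul_left_inj h0 hfin).mp h').symm
  have hdet' : |LinearMap.det A| = 1 := ENNReal.ofReal_eq_one.mp hdet
  refine ⟨(LinearMap.continuous_of_finiteDimensional A).measurable, ?_⟩
  rw [Measure.map_linearMap_addHaar_eq_smul_addHaar μ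
    (fun h => by rw [h, abs_zero] at hdet'; exact zero_ne_one hdet'), abs_inv, hdet']
  simp

/-- The space on which `Π₀` and `Π₁` are the two coordinate projections. -/
abbrev HalfSpace (n : ℕ) : Type := EuclideanSpace ℂ (Fin n)

/-- `ℂ^n × ℂ^n ≃ ℂ^(n+n)`. -/
def appendEquiv (n : ℕ) : (HalfSpace n × HalfSpace n) ≃ₗ[ℂ] (Fin (n + n) → ℂ) where
  toFun w := Fin.append (WithLp.ofLp w.1) (WithLp.ofLp w.2)
  invFun v := (WithLp.toLp 2 fun i => v (Fin.castAdd n i), WithLp.toLp 2 fun i => v (Fin.natAdd n i))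
  map_add' w w' := by
    funext i
    refine Fin.addCases (fun i => ?_) (fun i => ?_) i <;>
      simp [-Fin.natAdd_eq_addNat]
  map_smul' c w := by
    funext i
    refine Fin.addCases (fun i => ?_) (fun i => ?_) i <;>
      simp [-Fin.natAdd_eq_addNat]
  left_inv w := by ext <;> simp [-Fin.natAdd_eq_addNat]
  right_inv v := by
    funext i
    refine Fin.addCases (fun i => ?_) (fun i => ?_) i <;>
      simp [-Fin.natAdd_eq_addNat]

theorem sqSum_appendEquiv {n : ℕ} (w : HalfSpace n × HalfSpace n) :
    sqSum (appendEquiv n w) = ‖w.1‖ ^ 2 + ‖w.2‖ ^ 2 := by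
  rw [sqSum, Fin.sum_univ_add, EuclideanSpace.norm_sq_eq, EuclideanSpace.norm_sq_eq]
  simp [appendEquiv, -Fin.natAdd_eq_addNat]

theorem bias_appendEquiv {n : ℕ} (w : HalfSpace n × HalfSpace n) :
    bias (appendEquiv n w) = |‖w.1‖ ^ 2 - ‖w.2‖ ^ 2| := by
  have : (n + n) / 2 = n := by omega
  rw [bias, Fin.sum_univ_add, EuclideanSpace.norm_sq_eq, EuclideanSpace.norm_sq_eq]
  simp [appendEquiv, -Fin.natAdd_eq_addNat, this, sub_eq_add_neg]

/-- The action of a unitary matrix on `ℂ^n × ℂ^n`. -/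
def unitaryAction {n : ℕ} (V : unitaryGroup (Fin (n + n)) ℂ) :
    (HalfSpace n × HalfSpace n) →ₗ[ℝ] (HalfSpace n × HalfSpace n) :=
  LinearMap.restrictScalars ℝ ((appendEquiv n).symm.toLinearMap ∘ₗ
    (V : Matrix (Fin (n + n)) (Fin (n + n)) ℂ).mulVecLin ∘ₗ (appendEquiv n).toLinearMap)

theorem appendEquiv_unitaryAction {n : ℕ} (V : unitaryGroup (Fin (n + n)) ℂ)
    (w : HalfSpace n × HalfSpace n) : appendEquiv n (unitaryAction V w) =
      (V : Matrix (Fin (n + n)) (Fin (n + n)) ℂ) *ᵥ appendEquiv n w := by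
  simp [unitaryAction]

theorem normSq_unitaryAction {n : ℕ} (V : unitaryGroup (Fin (n + n)) ℂ)
    (w : HalfSpace n × HalfSpace n) :
    ‖(unitaryAction V w).1‖ ^ 2 + ‖(unitaryAction V w).2‖ ^ 2 = ‖w.1‖ ^ 2 + ‖w.2‖ ^ 2 := by
  rw [← sqSum_appendEquiv, ← sqSum_appendEquiv, appendEquiv_unitaryAction, sqSum_mulVec]

theorem measurePreserving_unitaryAction {n : ℕ} (V : unitaryGroup (Fin (n + n)) ℂ)
    (μ : Measure (HalfSpace n)) [μ.IsAddHaarMeasure] :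
    MeasurePreserving (unitaryAction V) (μ.prod μ) (μ.prod μ) := by
  have hc : Continuous fun w : HalfSpace n × HalfSpace n => ‖w.1‖ ^ 2 + ‖w.2‖ ^ 2 := by fun_prop
  have hopen : IsOpen {w : HalfSpace n × HalfSpace n | ‖w.1‖ ^ 2 + ‖w.2‖ ^ 2 < 1} :=
    isOpen_lt hc continuous_const
  have : (μ.prod μ).IsAddHaarMeasure := Measure.prod.instIsAddHaarMeasure μ μ
  refine measurePreserving_of_image_eq (μ.prod μ) (unitaryAction V)
    -- The product carries the sup norm, so the unitarily invariant Euclidean ball is written out.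
    (S := {w : HalfSpace n × HalfSpace n | ‖w.1‖ ^ 2 + ‖w.2‖ ^ 2 < 1}) ?_ ?_ ?_
  · refine Set.Subset.antisymm ?_ fun w hw => ⟨unitaryAction V⁻¹ w, ?_, ?_⟩
    · rintro _ ⟨w, hw, rfl⟩
      simpa [normSq_unitaryAction] using hw
    · simpa [normSq_unitaryAction] using hw
    · apply (appendEquiv n).injective
      rw [appendEquiv_unitaryAction, appendEquiv_unitaryAction, mulVec_mulVec]
      rw [← Submonoid.coe_mul, mul_inv_cancel, Submonoid.coe_one, one_mulVec]
  · exact (hopen.measure_pos _ ⟨0, by simp⟩).ne'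
  · refine (lt_of_le_of_lt (measure_mono ?_)
      (isCompact_closedBall (0 : HalfSpace n × HalfSpace n) 1).measure_lt_top).ne
    intro w hw
    have hw' : ‖w.1‖ ^ 2 + ‖w.2‖ ^ 2 < 1 := hw
    rw [mem_closedBall_zero_iff, Prod.norm_def, max_le_iff]
    constructor <;> nlinarith [norm_nonneg w.1, norm_nonneg w.2]

/-- A right translate of Haar measure is again a Haar probability measure, and on this compact group
that measure is unique. -/
theorem integral_mul_right_haarUnitary {d : ℕ} (W : unitaryGroup (Fin d) ℂ)
    (f : unitaryGroup (Fin d) ℂ → ℝ) :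
    ∫ V, f (V * W) ∂(haarUnitary d) = ∫ V, f V ∂(haarUnitary d) := by
  have : (haarUnitary d).IsHaarMeasure := inferInstanceAs (Measure.haarMeasure ⊤).IsHaarMeasure
  have hmap : Measure.map (fun V => V * W) (haarUnitary d) = haarUnitary d := by
    have : IsProbabilityMeasure (Measure.map (fun V => V * W) (haarUnitary d)) :=
      Measure.isProbabilityMeasure_map (by fun_prop)
    exact Measure.isHaarMeasure_eq_of_isProbabilityMeasure _ _
  conv_rhs => rw [← hmap]
  exact ((MeasurableEquiv.mulRight W).measurableEmbedding.integral_map f).symm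

theorem exists_unitary_mulVec_single {d : ℕ} (i₀ : Fin d) {v : Fin d → ℂ} (hv : sqSum v = 1) :
    ∃ W : unitaryGroup (Fin d) ℂ,
      (W : Matrix (Fin d) (Fin d) ℂ) *ᵥ Pi.single i₀ 1 = v := by
  have hn : ‖(WithLp.toLp 2 v : EuclideanSpace ℂ (Fin d))‖ = 1 := by
    have h : ‖(WithLp.toLp 2 v : EuclideanSpace ℂ (Fin d))‖ ^ 2 = 1 := by
      rw [EuclideanSpace.norm_sq_eq]
      exact hv
    nlinarith [norm_nonneg (WithLp.toLp 2 v : EuclideanSpace ℂ (Fin d))]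
  have ho : Orthonormal ℂ (({i₀} : Set (Fin d)).domRestrict
      fun _ => (WithLp.toLp 2 v : EuclideanSpace ℂ (Fin d))) := by
    refine ⟨fun i => hn, fun i j hij => absurd (Subsingleton.elim i j) hij⟩
  obtain ⟨b, hb⟩ := ho.exists_orthonormalBasis_extension_of_card_eq (by simp)
  -- The columns are an orthonormal basis extending `v`, placed at index `i₀`.
  refine ⟨⟨Matrix.of fun i k => b k i, ?_⟩, ?_⟩
  · rw [mem_unitaryGroup_iff']
    ext k l
    have h := orthonormal_iff_ite.mp b.orthonormal k l
    rw [PiLp.inner_apply] at h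
    rw [mul_apply, Matrix.one_apply, ← h]
    refine Finset.sum_congr rfl fun i _ => ?_
    simp [mul_comm]
  · rw [mulVec_single_one]
    funext i
    have := congrArg (fun x : EuclideanSpace ℂ (Fin d) => x i) (hb i₀ rfl)
    simpa using this

/-- The mean over a Haar-random `V` of the bias of `V v`. -/
def meanBias {d : ℕ} (v : Fin d → ℂ) : ℝ :=
  ∫ V, bias ((V : Matrix (Fin d) (Fin d) ℂ) *ᵥ v) ∂(haarUnitary d)

/-- Unitaries act transitively on unit vectors and Haar measure is right-invariant; the general case
follows by quadratic homogeneity. -/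
theorem meanBias_eq_mul {d : ℕ} (i₀ : Fin d) (v : Fin d → ℂ) :
    meanBias v = sqSum v * meanBias (Pi.single i₀ 1 : Fin d → ℂ) := by
  have h1 : ∀ u : Fin d → ℂ, sqSum u = 1 → meanBias u = meanBias (Pi.single i₀ 1 : Fin d → ℂ) := by
    intro u hu
    obtain ⟨W, hW⟩ := exists_unitary_mulVec_single i₀ hu
    rw [meanBias, meanBias, ← integral_mul_right_haarUnitary W
      fun V => bias ((V : Matrix (Fin d) (Fin d) ℂ) *ᵥ (Pi.single i₀ 1 : Fin d → ℂ))]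
    simp only [Submonoid.coe_mul, ← mulVec_mulVec, hW]
  rcases eq_or_lt_of_le (sqSum_nonneg v) with h0 | h0
  · rw [← h0, sqSum_eq_zero h0.symm]
    simp [meanBias, bias]
  · set c : ℝ := √(sqSum v) with hc
    have hc0 : 0 < c := Real.sqrt_pos.mpr h0
    have hcc : c ^ 2 = sqSum v := Real.sq_sqrt h0.le
    have hv : v = (c : ℂ) • ((c : ℂ)⁻¹ • v) := by
      rw [smul_smul, mul_inv_cancel₀ (by exact_mod_cast hc0.ne'), one_smul]
    have hu : sqSum ((c : ℂ)⁻¹ • v) = 1 := by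
      rw [sqSum_smul, ← hcc, norm_inv, Complex.norm_real, Real.norm_eq_abs, abs_of_pos hc0]
      field_simp
    rw [← h1 _ hu, ← hcc, meanBias, meanBias, ← integral_const_mul]
    conv_lhs => rw [hv]
    simp only [mulVec_smul, bias_smul]
    refine integral_congr_ae (ae_of_all _ fun V => ?_)
    simp only [Complex.norm_real, Real.norm_eq_abs, sq_abs]

instance secondCountableTopology_unitaryGroup (d : ℕ) :
    SecondCountableTopology (unitaryGroup (Fin d) ℂ) :=
  have : SecondCountableTopology (Matrix (Fin d) (Fin d) ℂ) :=
    inferInstanceAs (SecondCountableTopology (Fin d → Fin d → ℂ))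
  TopologicalSpace.Subtype.secondCountableTopology _

/-- The left integral is unchanged when `w` is replaced by `V w`. Averaging over `V` and exchanging
the integrals turns the bias into its Haar mean, a constant times `‖w‖²`. No integration on the
sphere or in coordinates on the group is needed. -/
theorem integral_bias_mul_exp {n : ℕ} (hn : 0 < n) (i₀ : Fin (n + n)) (μ : Measure (HalfSpace n))
    [μ.IsAddHaarMeasure] :
    ∫ w : HalfSpace n × HalfSpace n, |‖w.1‖ ^ 2 - ‖w.2‖ ^ 2| *
        Real.exp (-(‖w.1‖ ^ 2 + ‖w.2‖ ^ 2)) ∂(μ.prod μ) =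
      meanBias (Pi.single i₀ 1 : Fin (n + n) → ℂ) *
        ∫ w : HalfSpace n × HalfSpace n, (‖w.1‖ ^ 2 + ‖w.2‖ ^ 2) *
          Real.exp (-(‖w.1‖ ^ 2 + ‖w.2‖ ^ 2)) ∂(μ.prod μ) := by
  have : Nonempty (Fin n) := ⟨⟨0, hn⟩⟩
  have : Nontrivial (HalfSpace n) := inferInstance
  set G : HalfSpace n × HalfSpace n → ℝ := fun w => |‖w.1‖ ^ 2 - ‖w.2‖ ^ 2| *
        Real.exp (-(‖w.1‖ ^ 2 + ‖w.2‖ ^ 2)) with hG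
  have hGc : Continuous G := by fun_prop
  have h1 : ∀ V, ∫ w, G (unitaryAction V w) ∂(μ.prod μ) = ∫ w, G w ∂(μ.prod μ) := by
    intro V
    have hmp := measurePreserving_unitaryAction V μ
    conv_rhs => rw [← hmp.map_eq]
    rw [integral_map hmp.measurable.aemeasurable hGc.aestronglyMeasurable]
  have h2 : ∀ V w, G (unitaryAction V w) =
      bias ((V : Matrix (Fin (n + n)) (Fin (n + n)) ℂ) *ᵥ appendEquiv n w) *
        Real.exp (-(‖w.1‖ ^ 2 + ‖w.2‖ ^ 2)) := by
    intro V w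
    simp only [hG]
    rw [normSq_unitaryAction, ← bias_appendEquiv, appendEquiv_unitaryAction]
  have hT : Continuous (appendEquiv n) :=
    LinearMap.continuous_of_finiteDimensional (appendEquiv n).toLinearMap
  have hcont : Continuous fun z : unitaryGroup (Fin (n + n)) ℂ × (HalfSpace n × HalfSpace n) =>
      bias ((z.1 : Matrix (Fin (n + n)) (Fin (n + n)) ℂ) *ᵥ appendEquiv n z.2) *
        Real.exp (-(‖z.2.1‖ ^ 2 + ‖z.2.2‖ ^ 2)) := by
    refine (continuous_bias.comp (Continuous.matrix_mulVec
      (continuous_subtype_val.comp continuous_fst) (hT.comp continuous_snd))).mul ?_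
    fun_prop
  have hint : Integrable (Function.uncurry fun (V : unitaryGroup (Fin (n + n)) ℂ)
      (w : HalfSpace n × HalfSpace n) =>
      bias ((V : Matrix (Fin (n + n)) (Fin (n + n)) ℂ) *ᵥ appendEquiv n w) *
        Real.exp (-(‖w.1‖ ^ 2 + ‖w.2‖ ^ 2))) ((haarUnitary (n + n)).prod (μ.prod μ)) := by
    refine ((integrable_sq_add_sq_mul_exp μ).comp_snd (haarUnitary (n + n))).mono'
      hcont.aestronglyMeasurable (ae_of_all _ fun z => ?_)
    simp only [Function.uncurry]
    rw [norm_mul, Real.norm_eq_abs, Real.norm_eq_abs, Real.abs_exp, abs_of_nonneg (bias_nonneg _)]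
    gcongr
    refine (bias_le_sqSum _).trans (le_of_eq ?_)
    rw [sqSum_mulVec, sqSum_appendEquiv]
  calc ∫ w, G w ∂(μ.prod μ)
      = ∫ V, ∫ w, G (unitaryAction V w) ∂(μ.prod μ) ∂(haarUnitary (n + n)) := by
        simp only [h1, integral_const, probReal_univ, one_smul]
    _ = ∫ w, ∫ V, bias ((V : Matrix (Fin (n + n)) (Fin (n + n)) ℂ) *ᵥ appendEquiv n w) *
        Real.exp (-(‖w.1‖ ^ 2 + ‖w.2‖ ^ 2)) ∂(haarUnitary (n + n)) ∂(μ.prod μ) := by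
        simp only [h2]
        exact integral_integral_swap hint
    _ = _ := by
        rw [← integral_const_mul]
        refine integral_congr_ae (ae_of_all _ fun w => ?_)
        dsimp only
        rw [integral_mul_const]
        change meanBias (appendEquiv n w) * _ = _
        rw [meanBias_eq_mul i₀, sqSum_appendEquiv]
        ring

theorem meanBias_single {n : ℕ} (hn : 0 < n) (i₀ : Fin (n + n)) :
    meanBias (Pi.single i₀ 1 : Fin (n + n) → ℂ) = (n.centralBinom : ℝ) / 4 ^ n := by
  obtain ⟨j, rfl⟩ : ∃ j, n = j + 1 := ⟨n - 1, by omega⟩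
  have : Nontrivial (HalfSpace (j + 1)) := inferInstance
  have hE : Module.finrank ℝ (HalfSpace (j + 1)) = 2 * (j + 1) := by
    rw [finrank_real_of_complex]
    simp
  let μ : Measure (HalfSpace (j + 1)) := Measure.addHaar
  have h := integral_bias_mul_exp hn i₀ μ
  rw [integral_abs_sq_sub_sq_mul_exp μ hE, integral_sq_add_sq_mul_exp μ hE] at h
  have hc : (2 * (j + 1 : ℕ) * μ.real (Metric.ball 0 1)) ^ 2 ≠ 0 := by
    have hb : 0 < μ.real (Metric.ball (0 : HalfSpace (j + 1)) 1) :=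
      ENNReal.toReal_pos (Metric.measure_ball_pos μ 0 one_pos).ne' measure_ball_lt_top.ne
    positivity
  rw [mul_left_comm (meanBias _)] at h
  -- The sphere areas cancel; with `n = j + 1` what remains is `(2n)! / (2n 4^n)` divided by `(n-1)!
  -- n! / 2`.
  have h' := mul_left_cancel₀ hc h
  have hcb : ((j + 1).centralBinom : ℝ) * ((j + 1).factorial * (j + 1).factorial) =
      (2 * (j + 1)).factorial := by
    have := Nat.choose_mul_factorial_mul_factorial (show j + 1 ≤ 2 * (j + 1) by omega)
    rw [show 2 * (j + 1) - (j + 1) = j + 1 by omega] at this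
    rw [Nat.centralBinom_eq_two_mul_choose, ← this]
    push_cast
    ring
  have hf : ((j + 1).factorial : ℝ) = (j + 1 : ℕ) * j.factorial := by
    rw [Nat.factorial_succ]; push_cast; ring
  have hj : (j.factorial : ℝ) ≠ 0 := by positivity
  have hj1 : ((j + 1 : ℕ) : ℝ) ≠ 0 := by positivity
  rw [← hcb, hf] at h'
  rw [eq_div_iff (by positivity)]
  rw [one_div, inv_pow] at h'
  field_simp at h'
  linarith

end MeanBias

/-! ### Asymptotics of the central binomial coefficient -/

section CentralBinom

theorem sq_centralBinom_div_mul_W (n : ℕ) :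
    ((n.centralBinom : ℝ) / 4 ^ n) ^ 2 * ((2 * n + 1) * Real.Wallis.W n) = 1 := by
  have hcb : (n.centralBinom : ℝ) * (n.factorial * n.factorial) = (2 * n).factorial := by
    have := Nat.choose_mul_factorial_mul_factorial (show n ≤ 2 * n by omega)
    rw [show 2 * n - n = n by omega] at this
    rw [Nat.centralBinom_eq_two_mul_choose, ← this]
    push_cast
    ring
  have hf : (n.factorial : ℝ) ≠ 0 := by positivity
  have hb : (n.centralBinom : ℝ) ≠ 0 := by exact_mod_cast n.centralBinom_ne_zero
  have h1 : (2 * (n : ℝ) + 1) ≠ 0 := by positivity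
  have h4 : (4 : ℝ) ^ n ≠ 0 := by positivity
  have h16 : (2 : ℝ) ^ (4 * n) = (4 ^ n) ^ 2 := by
    rw [← pow_mul, show (4 : ℝ) = 2 ^ 2 by norm_num, ← pow_mul]
    congr 1
    ring
  rw [Real.Wallis.W_eq_factorial_ratio, ← hcb, h16]
  field_simp

/-- Wallis' bounds give `2/(π(2n+1)) ≤ c² ≤ 1/(πn) = t²`, so `t² - c²` is already of order `1/n²`,
which bounds `t - c` by order `1/n`. -/
theorem abs_centralBinom_sub_le {n : ℕ} (hn : 0 < n) :
    |(n.centralBinom : ℝ) / 4 ^ n - √(2 / (Real.pi * (n + n : ℕ)))| ≤ 1 / (n + n : ℕ) := by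
  set c : ℝ := (n.centralBinom : ℝ) / 4 ^ n with hc
  have hc0 : 0 ≤ c := by positivity
  have hn' : (1 : ℝ) ≤ n := by exact_mod_cast hn
  have hpi := Real.pi_gt_three
  have hW := sq_centralBinom_div_mul_W n
  rw [← hc] at hW
  have hW1 := Real.Wallis.W_le n
  have hW2 := Real.Wallis.le_W n
  set t : ℝ := √(2 / (Real.pi * (n + n : ℕ))) with ht
  have ht0 : 0 ≤ t := Real.sqrt_nonneg _
  have ht2 : t ^ 2 * (Real.pi * n) = 1 := by
    rw [ht, Real.sq_sqrt (by positivity)]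
    push_cast
    field_simp
    ring
  have hlow : 1 ≤ c ^ 2 * ((2 * n + 1) * (Real.pi / 2)) := by
    refine hW.symm.le.trans ?_
    gcongr
  have hup : c ^ 2 * ((2 * n + 1) * ((2 * n + 1) / (2 * n + 2) * (Real.pi / 2))) ≤ 1 := by
    refine le_trans ?_ hW.le
    gcongr
  have hct : c ^ 2 ≤ t ^ 2 := by
    have h1 : (n : ℝ) ≤ (2 * n + 1) * ((2 * n + 1) / (2 * n + 2) / 2) := by
      rw [div_div, ← mul_div_assoc, le_div_iff₀ (by positivity)]
      nlinarith
    have h2 : c ^ 2 * (Real.pi * n) ≤ t ^ 2 * (Real.pi * n) := by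
      rw [ht2]
      refine le_trans ?_ hup
      calc c ^ 2 * (Real.pi * n) ≤
          c ^ 2 * (Real.pi * ((2 * n + 1) * ((2 * n + 1) / (2 * n + 2) / 2))) := by gcongr
        _ = _ := by ring
    exact le_of_mul_le_mul_right h2 (by positivity)
  have hle : c ≤ t := abs_le_of_sq_le_sq' hct ht0 |>.2
  have hdiff : t ^ 2 - c ^ 2 ≤ (1 / (n + n : ℕ)) ^ 2 := by
    have e1 : t ^ 2 = 1 / (Real.pi * n) := by rw [eq_div_iff (by positivity), ht2]
    have e2 : 2 / (Real.pi * (2 * n + 1)) ≤ c ^ 2 := by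
      rw [div_le_iff₀ (by positivity)]
      linarith
    have e3 : 1 / (Real.pi * n) - 2 / (Real.pi * (2 * n + 1)) =
        1 / (Real.pi * n * (2 * n + 1)) := by
      field_simp
      ring
    have e4 : 1 / (Real.pi * n * (2 * n + 1)) ≤ 1 / (4 * (n : ℝ) ^ 2) := by
      apply one_div_le_one_div_of_le (by positivity)
      nlinarith [mul_pos (show (0 : ℝ) < n by linarith) (show (0 : ℝ) < n by linarith)]
    have e5 : (1 / ((n + n : ℕ) : ℝ)) ^ 2 = 1 / (4 * (n : ℝ) ^ 2) := by
      push_cast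
      rw [div_pow]
      ring_nf
    rw [e5, e1]
    linarith
  -- Since `0 ≤ c ≤ t`, `(t - c)² ≤ (t - c)(t + c) = t² - c²`.
  have hsq : (t - c) ^ 2 ≤ (1 / ((n + n : ℕ) : ℝ)) ^ 2 := by nlinarith
  rw [abs_sub_comm, abs_of_nonneg (by linarith)]
  exact abs_le_of_sq_le_sq' hsq (by positivity) |>.2

end CentralBinom

/-! ### The unassisted norm as a supremum of empirical biases -/

section Empirical

/-- Factor each difference of squares and apply Cauchy–Schwarz; the sums `‖w i‖ + ‖w' i‖` have
Euclidean norm at most `2`. -/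
theorem abs_bias_sub_bias_le {d : ℕ} {w w' : Fin d → ℂ} (hw : sqSum w ≤ 1) (hw' : sqSum w' ≤ 1) :
    |bias w - bias w'| ≤ 2 * √(sqSum (w - w')) := by
  refine (abs_abs_sub_abs_le_abs_sub _ _).trans ?_
  rw [← Finset.sum_sub_distrib]
  refine (Finset.abs_sum_le_sum_abs _ _).trans ?_
  calc _ ≤ ∑ i, ‖(w - w') i‖ * (‖w i‖ + ‖w' i‖) := by
        refine Finset.sum_le_sum fun i _ => ?_
        rw [← mul_sub, abs_mul, sq_sub_sq, abs_mul, abs_of_nonneg (by positivity : 0 ≤ ‖w i‖ + ‖w' i‖)]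
        have h1 : |if (i : ℕ) < d / 2 then (1 : ℝ) else -1| = 1 := by split_ifs <;> simp
        rw [h1, one_mul, mul_comm]
        gcongr
        exact abs_norm_sub_norm_le _ _
    _ ≤ √(∑ i, ‖(w - w') i‖ ^ 2) * √(∑ i, (‖w i‖ + ‖w' i‖) ^ 2) :=
        Real.sum_mul_le_sqrt_mul_sqrt _ _ _
    _ ≤ √(sqSum (w - w')) * 2 := by
        have h4 : ∑ i, (‖w i‖ + ‖w' i‖) ^ 2 ≤ 2 ^ 2 := by
          calc _ ≤ ∑ i, (2 * ‖w i‖ ^ 2 + 2 * ‖w' i‖ ^ 2) :=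
                Finset.sum_le_sum fun i _ => by nlinarith [sq_nonneg (‖w i‖ - ‖w' i‖)]
            _ = 2 * sqSum w + 2 * sqSum w' := by
                rw [Finset.sum_add_distrib, ← Finset.mul_sum, ← Finset.mul_sum]; rfl
            _ ≤ _ := by linarith
        have h5 : √(∑ i, (‖w i‖ + ‖w' i‖) ^ 2) ≤ 2 := Real.sqrt_le_iff.mpr ⟨by norm_num, h4⟩
        unfold sqSum
        gcongr
    _ = _ := mul_comm _ _

variable {d N : ℕ}

/-- The average over `j` of the bias of `U_j v`. -/
def empiricalBias (U : Fin N → unitaryGroup (Fin d) ℂ) (v : Fin d → ℂ) : ℝ :=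
  (∑ j, bias ((U j : Matrix (Fin d) (Fin d) ℂ) *ᵥ v)) / N

theorem empiricalBias_smul (U : Fin N → unitaryGroup (Fin d) ℂ) (c : ℂ) (v : Fin d → ℂ) :
    empiricalBias U (c • v) = ‖c‖ ^ 2 * empiricalBias U v := by
  simp only [empiricalBias, mulVec_smul, bias_smul, ← Finset.mul_sum, mul_div_assoc]

theorem empiricalBias_le_mul (U : Fin N → unitaryGroup (Fin d) ℂ) {B : ℝ}
    (hB : ∀ v, sqSum v = 1 → empiricalBias U v ≤ B) (v : Fin d → ℂ) :
    empiricalBias U v ≤ sqSum v * B := by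
  rcases eq_or_lt_of_le (sqSum_nonneg v) with h0 | h0
  · rw [← h0, sqSum_eq_zero h0.symm]
    simp [empiricalBias, bias]
  · set c : ℝ := √(sqSum v) with hc
    have hc0 : 0 < c := Real.sqrt_pos.mpr h0
    have hcc : c ^ 2 = sqSum v := Real.sq_sqrt h0.le
    have hv : v = (c : ℂ) • ((c : ℂ)⁻¹ • v) := by
      rw [smul_smul, mul_inv_cancel₀ (by exact_mod_cast hc0.ne'), one_smul]
    have hu : sqSum ((c : ℂ)⁻¹ • v) = 1 := by
      rw [sqSum_smul, ← hcc, norm_inv, Complex.norm_real, Real.norm_eq_abs, abs_of_pos hc0]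
      field_simp
    rw [hv, empiricalBias_smul, ← hv, Complex.norm_real, Real.norm_eq_abs, sq_abs, hcc]
    exact mul_le_mul_of_nonneg_left (hB _ hu) h0.le

/-- The Lipschitz constant depends neither on `N` nor on `U`, so one finite net serves all `N`. -/
theorem empiricalBias_le_add (U : Fin N → unitaryGroup (Fin d) ℂ) {v v' : Fin d → ℂ}
    (hv : sqSum v = 1) (hv' : sqSum v' = 1) :
    empiricalBias U v ≤ empiricalBias U v' + 2 * √(sqSum (v - v')) := by
  rcases Nat.eq_zero_or_pos N with rfl | hN
  · simp only [empiricalBias, Finset.univ_eq_empty, Finset.sum_empty, zero_div, zero_add]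
    positivity
  have hN' : (0 : ℝ) < N := by exact_mod_cast hN
  rw [empiricalBias, empiricalBias, div_add' _ _ _ hN'.ne']
  gcongr
  calc ∑ j, bias ((U j : Matrix (Fin d) (Fin d) ℂ) *ᵥ v)
      ≤ ∑ j, (bias ((U j : Matrix (Fin d) (Fin d) ℂ) *ᵥ v') + 2 * √(sqSum (v - v'))) := by
        refine Finset.sum_le_sum fun j _ => ?_
        have h := abs_bias_sub_bias_le (w := (U j : Matrix (Fin d) (Fin d) ℂ) *ᵥ v)
          (w' := (U j : Matrix (Fin d) (Fin d) ℂ) *ᵥ v')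
          (by rw [sqSum_mulVec, hv]) (by rw [sqSum_mulVec, hv'])
        rw [← mulVec_sub, sqSum_mulVec] at h
        linarith [le_abs_self (bias ((U j : Matrix (Fin d) (Fin d) ℂ) *ᵥ v) -
          bias ((U j : Matrix (Fin d) (Fin d) ℂ) *ᵥ v'))]
    _ = _ := by
        rw [Finset.sum_add_distrib]
        simp
        ring

theorem trace_halfProj_sub_mul_vecMulVec (w : Fin d → ℂ) :
    ((halfProj d 0 - halfProj d 1) * vecMulVec w (star w)).trace =
      ((∑ i : Fin d, (if (i : ℕ) < d / 2 then (1 : ℝ) else -1) * ‖w i‖ ^ 2 : ℝ) : ℂ) := by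
  rw [halfProj_zero, halfProj_one, diagonal_sub, Matrix.trace]
  push_cast
  refine Finset.sum_congr rfl fun i _ => ?_
  rw [diag_apply, diagonal_mul, vecMulVec_apply, Pi.star_apply, Complex.star_def, Complex.mul_conj']
  by_cases h : (i : ℕ) < d / 2
  · simp [h, not_le.mpr h]
  · simp [h, not_lt.mp h]

theorem norm_trace_halfProj_sub_mul_vecMulVec (w : Fin d → ℂ) :
    ‖((halfProj d 0 - halfProj d 1) * vecMulVec w (star w)).trace‖ = bias w := by
  rw [trace_halfProj_sub_mul_vecMulVec, Complex.norm_real, Real.norm_eq_abs, bias]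

theorem conj_vecMulVec (V : Matrix (Fin d) (Fin d) ℂ) (w : Fin d → ℂ) :
    V * vecMulVec w (star w) * Vᴴ = vecMulVec (V *ᵥ w) (star (V *ᵥ w)) := by
  rw [mul_vecMulVec, vecMulVec_mul, star_mulVec]

/-- The difference is diagonal with opposite entries at `(j, 0)` and `(j, 1)`, whence the factor
`2`. -/
theorem traceNorm_sub_apply (U : Fin N → unitaryGroup (Fin d) ℂ) (ρ : Matrix (Fin d) (Fin d) ℂ) :
    traceNorm ((randomBinaryChannel U 0 - randomBinaryChannel U 1) ρ) =
      2 * ((∑ j, ‖((halfProj d 0 - halfProj d 1) * ((U j : Matrix (Fin d) (Fin d) ℂ) * ρ *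
        (U j : Matrix (Fin d) (Fin d) ℂ)ᴴ)).trace‖) / N) := by
  rw [LinearMap.sub_apply, randomBinaryChannel_apply, randomBinaryChannel_apply, diagonal_sub,
    traceNorm_diagonal, Fintype.sum_prod_type, Finset.sum_div, Finset.mul_sum]
  refine Finset.sum_congr rfl fun j _ => ?_
  rw [Fin.sum_univ_two]
  dsimp only
  generalize (U j : Matrix (Fin d) (Fin d) ℂ) * ρ * (U j : Matrix (Fin d) (Fin d) ℂ)ᴴ = M
  simp only [← mul_sub, ← trace_sub, ← sub_mul, norm_mul]
  have h : ‖((halfProj d (1 + 0) - halfProj d (1 + 1)) * M).trace‖ =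
      ‖((halfProj d 0 - halfProj d 1) * M).trace‖ := by
    rw [show ((1 : Fin 2) + 0) = 1 from rfl, show ((1 : Fin 2) + 1) = 0 from rfl,
      ← neg_sub (halfProj d 0), neg_mul, trace_neg, norm_neg]
  rw [h, zero_add, zero_add]
  simp
  ring

theorem traceNorm_sub_apply_vecMulVec (U : Fin N → unitaryGroup (Fin d) ℂ) (v : Fin d → ℂ) :
    traceNorm ((randomBinaryChannel U 0 - randomBinaryChannel U 1) (vecMulVec v (star v))) =
      2 * empiricalBias U v := by
  rw [traceNorm_sub_apply]
  simp only [conj_vecMulVec, norm_trace_halfProj_sub_mul_vecMulVec]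
  rfl

/-- Convexity: `ρ` is a sum of unnormalized pure states whose squared norms add up to `1`, and the
bias is quadratically homogeneous. -/
theorem traceNorm_sub_apply_le (U : Fin N → unitaryGroup (Fin d) ℂ) {B : ℝ}
    (hB : ∀ v, sqSum v = 1 → empiricalBias U v ≤ B) {ρ : Matrix (Fin d) (Fin d) ℂ}
    (hρ : IsDensity ρ) :
    traceNorm ((randomBinaryChannel U 0 - randomBinaryChannel U 1) ρ) ≤ 2 * B := by
  obtain ⟨C, rfl⟩ := exists_eq_conjTranspose_mul_self hρ.1
  let c : Fin d → Fin d → ℂ := fun k i => star (C k i)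
  have hC : Cᴴ * C = ∑ k, vecMulVec (c k) (star (c k)) := by
    ext i j
    simp [mul_apply, Matrix.sum_apply, vecMulVec_apply, c]
  have hsum : ∑ k, sqSum (c k) = 1 := by
    apply Complex.ofReal_injective
    have h := hρ.2
    rw [hC, trace_sum] at h
    simp only [trace_vecMulVec] at h
    push_cast
    simp only [ofReal_sqSum, dotProduct_comm (star _)]
    exact h
  rw [traceNorm_sub_apply]
  gcongr
  calc _ ≤ (∑ j, ∑ k, bias ((U j : Matrix (Fin d) (Fin d) ℂ) *ᵥ c k)) / N := by
        gcongr with j _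
        rw [hC, Finset.mul_sum, Finset.sum_mul, Finset.mul_sum, trace_sum]
        refine (norm_sum_le _ _).trans (le_of_eq (Finset.sum_congr rfl fun k _ => ?_))
        rw [conj_vecMulVec, norm_trace_halfProj_sub_mul_vecMulVec]
    _ = ∑ k, empiricalBias U (c k) := by
        rw [Finset.sum_comm, Finset.sum_div]
        rfl
    _ ≤ ∑ k, sqSum (c k) * B := Finset.sum_le_sum fun k _ => empiricalBias_le_mul U hB (c k)
    _ = B := by rw [← Finset.sum_mul, hsum, one_mul]

theorem neNorm_mem_Icc (U : Fin N → unitaryGroup (Fin d) ℂ) {B : ℝ}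
    (hB : ∀ v, sqSum v = 1 → empiricalBias U v ≤ B) {v₀ : Fin d → ℂ} (hv₀ : sqSum v₀ = 1) :
    neNorm (randomBinaryChannel U 0 - randomBinaryChannel U 1) ∈
      Set.Icc (2 * empiricalBias U v₀) (2 * B) := by
  have hd : IsDensity (vecMulVec v₀ (star v₀)) := by
    refine ⟨posSemidef_vecMulVec_self_star _, ?_⟩
    rw [trace_vecMulVec, dotProduct_comm, ← ofReal_sqSum, hv₀, Complex.ofReal_one]
  have hmem : 2 * empiricalBias U v₀ ∈ {r : ℝ | ∃ ρ : Matrix (Fin d) (Fin d) ℂ, IsDensity ρ ∧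
      r = traceNorm ((randomBinaryChannel U 0 - randomBinaryChannel U 1) ρ)} :=
    ⟨_, hd, (traceNorm_sub_apply_vecMulVec U v₀).symm⟩
  have hub : ∀ r ∈ {r : ℝ | ∃ ρ : Matrix (Fin d) (Fin d) ℂ, IsDensity ρ ∧
      r = traceNorm ((randomBinaryChannel U 0 - randomBinaryChannel U 1) ρ)}, r ≤ 2 * B := by
    rintro r ⟨ρ, hρ, rfl⟩
    exact traceNorm_sub_apply_le U hB hρ
  exact ⟨le_csSup ⟨2 * B, hub⟩ hmem, csSup_le ⟨_, hmem⟩ hub⟩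

end Empirical

/-! ### The law of large numbers -/

section LLN

open ProbabilityTheory

/-- The strong law of large numbers for a function of independent samples. -/
theorem ae_tendsto_sum_infinitePi {Ω : Type} [MeasurableSpace Ω] {μ : Measure Ω}
    [IsProbabilityMeasure μ] {f : Ω → ℝ} (hf : Measurable f) (hint : Integrable f μ) :
    ∀ᵐ ω ∂(Measure.infinitePi fun _ : ℕ => μ),
      Tendsto (fun N : ℕ => (∑ i ∈ Finset.range N, f (ω i)) / N) atTop (𝓝 (∫ x, f x ∂μ)) := by
  have hmp := fun i : ℕ => measurePreserving_eval_infinitePi (fun _ : ℕ => μ) i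
  have hid : ∀ i : ℕ, IdentDistrib (fun ω : ℕ → Ω => f (ω i)) f
      (Measure.infinitePi fun _ : ℕ => μ) μ := fun i =>
    ⟨(hf.comp (hmp i).measurable).aemeasurable, hf.aemeasurable, by
      conv_rhs => rw [← (hmp i).map_eq, Measure.map_map hf (hmp i).measurable]
      rfl⟩
  have h := strong_law_ae_real (fun (i : ℕ) (ω : ℕ → Ω) => f (ω i))
    ((hid 0).integrable_iff.mpr hint)
    (fun i j hij => (iIndepFun_infinitePi (P := fun _ : ℕ => μ)
      (X := fun _ => f) fun _ => hf).indepFun hij)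
    (fun i => (hid i).trans (hid 0).symm)
  rwa [(hid 0).integral_eq] at h

theorem ae_tendsto_empiricalBias {d : ℕ} (v : Fin d → ℂ) :
    ∀ᵐ U ∂(Measure.infinitePi fun _ : ℕ => haarUnitary d),
      Tendsto (fun N : ℕ => empiricalBias (fun j : Fin N => U j) v) atTop (𝓝 (meanBias v)) := by
  let f : unitaryGroup (Fin d) ℂ → ℝ := fun V => bias ((V : Matrix (Fin d) (Fin d) ℂ) *ᵥ v)
  have hfc : Continuous f := continuous_bias.comp
    (Continuous.matrix_mulVec continuous_subtype_val continuous_const)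
  have hf : Measurable f := hfc.measurable
  have hint : Integrable f (haarUnitary d) := by
    refine Integrable.of_bound hf.aestronglyMeasurable (sqSum v) (ae_of_all _ fun V => ?_)
    rw [Real.norm_eq_abs, abs_of_nonneg (bias_nonneg _), ← sqSum_mulVec V]
    exact bias_le_sqSum _
  filter_upwards [ae_tendsto_sum_infinitePi hf hint] with U hU
  refine hU.congr fun N => ?_
  rw [empiricalBias, Finset.sum_range]

theorem exists_finite_net (d : ℕ) {ε : ℝ} (hε : 0 < ε) : ∃ t : Set (Fin d → ℂ), t.Finite ∧
    (∀ v ∈ t, sqSum v = 1) ∧ ∀ v, sqSum v = 1 → ∃ v' ∈ t, √(sqSum (v - v')) ≤ ε := by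
  have hn : ∀ x : EuclideanSpace ℂ (Fin d), ‖x‖ = √(sqSum (WithLp.ofLp x)) := fun x =>
    EuclideanSpace.norm_eq x
  obtain ⟨t, hts, htf, hcov⟩ := (isCompact_sphere (0 : EuclideanSpace ℂ (Fin d)) 1).finite_cover_balls
    hε
  refine ⟨WithLp.ofLp '' t, htf.image _, ?_, fun v hv => ?_⟩
  · rintro _ ⟨x, hx, rfl⟩
    have h := mem_sphere_zero_iff_norm.mp (hts hx)
    rwa [hn, Real.sqrt_eq_one] at h
  · have hmem : WithLp.toLp 2 v ∈ Metric.sphere (0 : EuclideanSpace ℂ (Fin d)) 1 := by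
      rw [mem_sphere_zero_iff_norm, hn, Real.sqrt_eq_one]
      exact hv
    obtain ⟨x, hx, hxv⟩ := Set.mem_iUnion₂.mp (hcov hmem)
    refine ⟨_, ⟨x, hx, rfl⟩, ?_⟩
    rw [Metric.mem_ball, dist_eq_norm, hn] at hxv
    exact hxv.le

/-- With `ε = 1/d`, the empirical bias eventually exceeds its mean by at most `3ε` on the sphere
(`ε` from the law of large numbers, `2ε` from the net) and is at least the mean minus `ε` at a net
point. After doubling, and with `2ε` for the central binomial estimate, the error is at most `8ε`.
-/
theorem ae_eventually_abs_neNorm_sub_le {d : ℕ} (hd : 0 < d) (hd2 : Even d) :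
    ∀ᵐ U ∂(Measure.infinitePi fun _ : ℕ => haarUnitary d), ∀ᶠ N : ℕ in atTop,
      |neNorm (randomBinaryChannel (fun j : Fin N => U j) 0 -
            randomBinaryChannel (fun j : Fin N => U j) 1) -
          2 * √(2 / (Real.pi * d))| ≤ 8 / d := by
  obtain ⟨n, rfl⟩ := hd2
  have hn : 0 < n := by omega
  let i₀ : Fin (n + n) := ⟨0, hd⟩
  have hε : (0 : ℝ) < 1 / (n + n : ℕ) := by positivity
  obtain ⟨t, htf, ht1, hnet⟩ := exists_finite_net (n + n) hε
  have hκ : ∀ v : Fin (n + n) → ℂ, sqSum v = 1 → meanBias v = (n.centralBinom : ℝ) / 4 ^ n := by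
    intro v hv
    rw [meanBias_eq_mul i₀, hv, one_mul, meanBias_single hn]
  have hae : ∀ᵐ U ∂(Measure.infinitePi fun _ : ℕ => haarUnitary (n + n)), ∀ v ∈ t,
      Tendsto (fun N : ℕ => empiricalBias (fun j : Fin N => U j) v) atTop (𝓝 (meanBias v)) :=
    (ae_ball_iff htf.countable).mpr fun v _ => ae_tendsto_empiricalBias v
  filter_upwards [hae] with U hU
  have hev : ∀ᶠ N : ℕ in atTop, ∀ v ∈ t, |empiricalBias (fun j : Fin N => U j) v -
      (n.centralBinom : ℝ) / 4 ^ n| < 1 / (n + n : ℕ) := by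
    refine (eventually_all_finite htf).mpr fun v hv => ?_
    have h := Metric.tendsto_nhds.mp (hU v hv) _ hε
    simpa only [hκ v (ht1 v hv), Real.dist_eq] using h
  filter_upwards [hev] with N hN
  have hs : sqSum (Pi.single i₀ 1 : Fin (n + n) → ℂ) = 1 := by
    rw [sqSum, Finset.sum_eq_single i₀]
    · simp
    · intro i _ hi
      simp [hi]
    · simp
  -- Any net point serves for the lower bound; a basis vector shows that the net is nonempty.
  obtain ⟨v₀, hv₀, -⟩ := hnet _ hs
  have hB : ∀ v, sqSum v = 1 → empiricalBias (fun j : Fin N => U j) v ≤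
      (n.centralBinom : ℝ) / 4 ^ n + 3 * (1 / (n + n : ℕ)) := by
    intro v hv
    obtain ⟨v', hv', hvv⟩ := hnet v hv
    have h1 := empiricalBias_le_add (fun j : Fin N => U j) hv (ht1 v' hv')
    have h2 := (abs_lt.mp (hN v' hv')).2
    linarith
  obtain ⟨h1, h2⟩ := neNorm_mem_Icc (fun j : Fin N => U j) hB (ht1 v₀ hv₀)
  have h3 := (abs_lt.mp (hN v₀ hv₀)).1
  have h4 := abs_le.mp (abs_centralBinom_sub_le hn)
  have e8 : (8 : ℝ) / (n + n : ℕ) = 8 * (1 / (n + n : ℕ)) := by ring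
  rw [e8, abs_le]
  constructor <;> linarith [h4.1, h4.2]

end LLN

end ChannelDiscrimination
end

open ChannelDiscrimination
theorem mainTheorem6 :
    (∀ (d N : ℕ), 0 < d → Even d → 0 < N → ∀ U : Fin N → unitaryGroup (Fin d) ℂ,
      (∀ a, IsChannel (randomBinaryChannel U a)) ∧
      IsOneWayLOCC (discriminator U) ∧
      (∀ a b : Fin 2,
        hsInner (discriminator U b) (tensorId (Fin d) (randomBinaryChannel U a) (maxEntangled d)) =
          if b = a then 1 else 0) ∧
      (∀ (Z : Type) [Fintype Z] [DecidableEq Z], d ≤ Fintype.card Z →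
        loccNorm Z (randomBinaryChannel U 0 - randomBinaryChannel U 1) = 2) ∧
      diamondNorm (randomBinaryChannel U 0 - randomBinaryChannel U 1) = 2) ∧
    ∃ C : ℝ, ∀ d : ℕ, 0 < d → Even d →
      (∃ N₀ : ℕ, ∀ N ≥ N₀, ∃ U : Fin N → unitaryGroup (Fin d) ℂ,
        |neNorm (randomBinaryChannel U 0 - randomBinaryChannel U 1) -
            2 * √(2 / (Real.pi * d))| ≤ C / d) ∧
      ∀ᵐ U ∂(Measure.infinitePi fun _ : ℕ => haarUnitary d), ∀ᶠ N : ℕ in atTop,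
        |neNorm (randomBinaryChannel (fun j : Fin N => U j) 0 -
              randomBinaryChannel (fun j : Fin N => U j) 1) -
            2 * √(2 / (Real.pi * d))| ≤ C / d := by
  refine ⟨fun d N hd hd2 hN U => ⟨isChannel_randomBinaryChannel hN U,
    isOneWayLOCC_discriminator U, hsInner_discriminator hd hd2 hN U,
    fun Z _ _ hZ => loccNorm_eq_two hd hd2 hN U Z hZ, diamondNorm_eq_two hd hd2 hN U⟩,
    8, fun d hd hd2 => ?_⟩
  have hae := ae_eventually_abs_neNorm_sub_le hd hd2
  refine ⟨?_, hae⟩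
  -- An almost sure event is nonempty, so the initial segments of a single sequence work for all
  -- large `N`.
  obtain ⟨U, hU⟩ := hae.exists
  obtain ⟨N₀, hN₀⟩ := eventually_atTop.mp hU
  exact ⟨N₀, fun N hN => ⟨fun j => U j, hN₀ N hN⟩⟩
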